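/- **Definitions.** Let $n\ge 3$, let $\mathcal F$ be an additive category and $\Sigma$ an autoequivalence of $\mathcal F$. An $n$-$\Sigma$-sequence is a sequence of morphisms $X_\bullet=(X_1\xrightarrow{\alpha_1}X_2\xrightarrow{\alpha_2}\cdots\xrightarrow{\alpha_{n-1}}X_n\xrightarrow{\alpha_n}\Sigma X_1)$ in $\mathcal F$. A morphism $X_\bullet\to Y_\bullet$ (with $Y_\bullet$ having morphisms $\beta_i$) is a family $\varphi_i\colon X_i\to Y_i$, $1\le i\le n$, with $\varphi_{i+1}\alpha_i=\beta_i\varphi_i$ for $1\le i\le n$, where $\varphi_{n+1}:=\Sigma\varphi_1$. The triple $(\mathcal F,\Sigma,\mathcal X)$, with $\mathcal X$ a class of $n$-$\Sigma$-sequences (called $n$-angles), is an $n$-angulated category if the following hold. * (F1) (a) $\mathcal X$ is closed under (finite) direct sums and under direct summands. (b) For every $X\in\mathcal F$ the sequence $X\xrightarrow{1}X\to0\to\cdots\to0\to\Sigma X$ is in $\mathcal X$. (c) Every morphism $\alpha_1\colon X_1\to X_2$ of $\mathcal F$ is the first morphism of some $n$-angle. * (F2) $X_\bullet\in\mathcal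 X$ if and only if its left rotation $X_2\xrightarrow{\alpha_2}X_3\to\cdots\xrightarrow{\alpha_n}\Sigma X_1\xrightarrow{(-1)^n\Sigma\alpha_1}\Sigma X_2$ is in $\mathcal X$. * (F3) For $X_\bullet,Y_\bullet\in\mathcal X$ and $\varphi_1\colon X_1\to Y_1$, $\varphi_2\colon X_2\to Y_2$ with $\varphi_2\alpha_1=\beta_1\varphi_1$, there are $\varphi_3,\dots,\varphi_n$ that complete $(\varphi_1,\varphi_2)$ to a morphism $X_\bullet\to Y_\bullet$. * (F4) In the situation of (F3), $\varphi_3,\dots,\varphi_n$ can be chosen so that moreover the cone $$X_2\oplus Y_1\to X_3\oplus Y_2\to\cdots\to X_n\oplus Y_{n-1}\to\Sigma X_1\oplus Y_n\to\Sigma X_2\oplus\Sigma Y_1$$ is in $\mathcal X$, where the $i$-th morphism is $\begin{pmatrix}-\alpha_{i+1}&0\\ \varphi_{i+1}&\beta_i\end{pmatrix}$ for $1\le i\le n$, with $\alpha_{n+1}:=\Sigma\alpha_1$ and $\varphi_{n+1}:=\Sigma\varphi_1$. Let $\mathcal T$ be a triangulated category with suspension $\Sigma_3$ and let $d\ge1$.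 A full subcategory $\mathcal F\subseteq\mathcal T$ is $d$-cluster tilting if every object of $\mathcal T$ has a left and a right $\mathcal F$-approximation (that is, $\mathcal F$ is functorially finite) and $$\mathcal F=\{X\mid\mathcal T(\mathcal F,\Sigma_3^iX)=0\ \ \forall\,0<i<d\}=\{X\mid\mathcal T(X,\Sigma_3^i\mathcal F)=0\ \ \forall\,0<i<d\}.$$ **Theorem 3.1.** Let $n\ge3$, let $\mathcal T$ be a triangulated category with suspension $\Sigma_3$, and let $\mathcal F\subseteq\mathcal T$ be an $(n-2)$-cluster tilting subcategory that is closed under $\Sigma_3^{n-2}$. Then $\mathcal F$ is additive, $\Sigma_3^{n-2}$ restricts to an autoequivalence of $\mathcal F$, and $(\mathcal F,\Sigma_3^{n-2},\mathcal X)$ is an $n$-angulated category, where $\mathcal X$ is the class of all sequences $$X_1\xrightarrow{\alpha_1}X_2\xrightarrow{\alpha_2}\cdots\xrightarrow{\alpha_{n-1}}X_n\xrightarrow{\alpha_n}\Sigma_3^{n-2}X_1$$ in $\mathcal F$ that arise by splicing $n-2$ triangles of $\mathcal T$. This means: there are objects $X_{2.5},X_{3.5},\dots,X_{n-1.5}$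 of $\mathcal T$ and, with $X_{1.5}:=X_1$ and $X_{n-0.5}:=X_n$, distinguished triangles $$X_{i-0.5}\xrightarrow{f_i}X_i\xrightarrow{g_i}X_{i+0.5}\xrightarrow{h_i}\Sigma_3X_{i-0.5}\qquad(2\le i\le n-1)$$ such that $\alpha_1=f_2$, $\alpha_i=f_{i+1}g_i$ for $2\le i\le n-2$, $\alpha_{n-1}=g_{n-1}$, and $$\alpha_n=\Sigma_3^{n-3}h_2\circ\cdots\circ\Sigma_3h_{n-2}\circ h_{n-1}.$$ -/

import Mathlib

open CategoryTheory CategoryTheory.Limits CategoryTheory.Pretriangulated ZeroObject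

universe v u v' u'

noncomputable section

namespace HigherAngulated

/-- A string `X ⟶ X₂ ⟶ ⋯ ⟶ Z` of `n ≥ 1` composable morphisms from `X` to `Z`. -/
inductive Chain {A : Type u} [Category.{v} A] (Z : A) : ℕ → A → Type (max u v)
  | single {X : A} (f : X ⟶ Z) : Chain Z 1 X
  | cons {k : ℕ} {X Y : A} (f : X ⟶ Y) (c : Chain Z k Y) : Chain Z (k + 1) X

namespace Chain

section

variable {A : Type u} [Category.{v} A]

/-- The second object of a chain (the end point, if the chain has only one morphism). -/
def second {Z : A} : {n : ℕ} → {X : A} → Chain Z n X → A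
  | _, _, single _ => Z
  | _, _, cons (Y := Y) _ _ => Y

/-- The first morphism of a chain. -/
def head {Z : A} : {n : ℕ} → {X : A} → (c : Chain Z n X) → (X ⟶ c.second)
  | _, _, single f => f
  | _, _, cons f _ => f

/-- Append a morphism at the end of a chain. -/
def snoc {Z W : A} (g : Z ⟶ W) : {n : ℕ} → {X : A} → Chain Z n X → Chain W (n + 1) X
  | _, _, single f => cons f (single g)
  | _, _, cons f c => cons f (snoc g c)

/-- Remove the first morphism of a chain and append a morphism at its end. -/
def tailSnoc {Z W : A} (g : Z ⟶ W) :
    {n : ℕ} → {X : A} → (c : Chain Z n X) → Chain W n c.second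
  | _, _, single _ => single g
  | _, _, cons _ c => snoc g c

/-- The image of a chain under a functor. -/
def map {B : Type u'} [Category.{v'} B] (G : A ⥤ B) {Z : A} :
    {n : ℕ} → {X : A} → Chain Z n X → Chain (G.obj Z) n (G.obj X)
  | _, _, single f => single (G.map f)
  | _, _, cons f c => cons (G.map f) (map G c)

/-- The chain `c` has at least two morphisms and its first one is `f`. -/
inductive StartsWith {Z : A} : {n : ℕ} → {X Y : A} → Chain Z n X → (X ⟶ Y) → Prop
  | intro {k : ℕ} {X Y : A} (f : X ⟶ Y) (c : Chain Z k Y) : StartsWith (cons f c) f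

/-- A morphism between two chains with the same number of morphisms,
```
  X ⟶ X₂ ⟶ ⋯ ⟶ Z
  |a   |         |b
  v    v         v
  X' ⟶ X₂' ⟶ ⋯ ⟶ Z'
```
whose outer vertical morphisms are the prescribed `a` and `b`. -/
inductive Hom {Z Z' : A} (b : Z ⟶ Z') :
    {n : ℕ} → {X X' : A} → Chain Z n X → Chain Z' n X' → (X ⟶ X') → Type (max u v)
  | single {X X' : A} {f : X ⟶ Z} {f' : X' ⟶ Z'} {a : X ⟶ X'} (w : f ≫ b = a ≫ f') :
      Hom b (Chain.single f) (Chain.single f') a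
  | cons {k : ℕ} {X Y X' Y' : A} {f : X ⟶ Y} {f' : X' ⟶ Y'} {c : Chain Z k Y}
      {c' : Chain Z' k Y'} {a : X ⟶ X'} (m : Y ⟶ Y') (w : f ≫ m = a ≫ f') (φ : Hom b c c' m) :
      Hom b (Chain.cons f c) (Chain.cons f' c') a

/-- The second vertical morphism of a morphism of chains. -/
def Hom.second {Z Z' : A} {b : Z ⟶ Z'} : {n : ℕ} → {X X' : A} → {c : Chain Z n X} →
    {c' : Chain Z' n X'} → {a : X ⟶ X'} → Hom b c c' a → (c.second ⟶ c'.second)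
  | _, _, _, _, _, _, Hom.single _ => b
  | _, _, _, _, _, _, Hom.cons m _ _ => m

/-- Two chains are isomorphic through isomorphisms of which the first and the last are `a`, `b`. -/
inductive IsIsomorphic {Z Z' : A} (b : Z ≅ Z') :
    {n : ℕ} → {X X' : A} → Chain Z n X → Chain Z' n X' → (X ≅ X') → Prop
  | single {X X' : A} {f : X ⟶ Z} {f' : X' ⟶ Z'} {a : X ≅ X'} (w : f ≫ b.hom = a.hom ≫ f') :
      IsIsomorphic b (Chain.single f) (Chain.single f') a
  | cons {k : ℕ} {X Y X' Y' : A} {f : X ⟶ Y} {f' : X' ⟶ Y'} {c : Chain Z k Y}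
      {c' : Chain Z' k Y'} {a : X ≅ X'} (m : Y ≅ Y') (w : f ≫ m.hom = a.hom ≫ f')
      (h : IsIsomorphic b c c' m) :
      IsIsomorphic b (Chain.cons f c) (Chain.cons f' c') a

end

section

variable {A : Type u} [Category.{v} A] [Preadditive A]

/-- The chain `X ⟶ 0 ⟶ ⋯ ⟶ 0 ⟶ Z` with `k + 1` morphisms. -/
def zeros [HasZeroObject A] (Z : A) : (k : ℕ) → (X : A) → Chain Z (k + 1) X
  | 0, _ => single 0
  | k + 1, _ => cons (0 : _ ⟶ (0 : A)) (zeros Z k 0)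

/-- The direct sum of the chains `X ⟶ X₂ ⟶ ⋯ ⟶ Xₙ ⟶ Z` and `X' ⟶ X₂' ⟶ ⋯ ⟶ Xₙ' ⟶ Z'`,
continued at its end by the morphisms `l : Z ⟶ W` and `r : Z' ⟶ W`:
`X ⊞ X' ⟶ X₂ ⊞ X₂' ⟶ ⋯ ⟶ Xₙ ⊞ Xₙ' ⟶ W`. -/
def sum [HasBinaryBiproducts A] {Z Z' W : A} (l : Z ⟶ W) (r : Z' ⟶ W) :
    {n : ℕ} → {X X' : A} → Chain Z n X → Chain Z' n X' → Chain W n (X ⊞ X')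
  | _, _, _, single f, single f' => single (biprod.desc (f ≫ l) (f' ≫ r))
  | _, _, _, cons f c, cons f' c' => cons (biprod.map f f') (sum l r c c')
  | _, _, _, single _, cons _ c' => nomatch c'
  | _, _, _, cons _ c, single _ => nomatch c

/-- For a morphism `φ` from `X ⟶ X₂ ⟶ ⋯ ⟶ Xₙ ⟶ Z` (with morphisms `αᵢ`) to
`Y ⟶ Y₂ ⟶ ⋯ ⟶ Yₙ ⟶ Z'` (with morphisms `βᵢ`) and for `l : Z ⟶ W`, `r : Z' ⟶ W`, the chain
`X₂ ⊞ Y ⟶ X₃ ⊞ Y₂ ⟶ ⋯ ⟶ Z ⊞ Yₙ ⟶ W`. Its `i`-th morphism, for `i < n`, has the components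
`-αᵢ₊₁ : Xᵢ₊₁ ⟶ Xᵢ₊₂`, `φᵢ₊₁ : Xᵢ₊₁ ⟶ Yᵢ₊₁`, `0 : Yᵢ ⟶ Xᵢ₊₂` and `βᵢ : Yᵢ ⟶ Yᵢ₊₁`
(where `Xₙ₊₁ = Z`); its last one has the components `l` and `βₙ ≫ r`. -/
def Hom.cone [HasBinaryBiproducts A] {Z Z' W : A} {b : Z ⟶ Z'} (l : Z ⟶ W) (r : Z' ⟶ W) :
    {n : ℕ} → {X Y : A} → {c : Chain Z n X} → {c' : Chain Z' n Y} → {a : X ⟶ Y} →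
      Hom b c c' a → Chain W n (c.second ⊞ Y)
  | _, _, _, _, _, _, Hom.single (f' := f') _ => Chain.single (biprod.desc l (f' ≫ r))
  | _, _, _, _, _, _, Hom.cons (f' := f') (c := c) m _ φ =>
      Chain.cons (biprod.desc (biprod.lift (-c.head) m) (biprod.lift 0 f')) (φ.cone l r)

end

end Chain

/-- An `n`-`S`-sequence `X₁ ⟶ X₂ ⟶ ⋯ ⟶ Xₙ ⟶ S X₁`. -/
structure NSeq {A : Type u} [Category.{v} A] (S : A ⥤ A) (n : ℕ) where
  /-- the first object -/
  X₁ : A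
  /-- the `n` morphisms -/
  chain : Chain (S.obj X₁) n X₁

namespace NSeq

variable {A : Type u} [Category.{v} A] {S : A ⥤ A} {n : ℕ}

/-- The morphisms of `n`-`S`-sequences with first component `φ₁` (and hence last one `S φ₁`). -/
abbrev Hom (X Y : NSeq S n) (φ₁ : X.X₁ ⟶ Y.X₁) : Type (max u v) :=
  Chain.Hom (S.map φ₁) X.chain Y.chain φ₁

/-- Isomorphic `n`-`S`-sequences. -/
def IsIsomorphic (X Y : NSeq S n) : Prop :=
  ∃ e : X.X₁ ≅ Y.X₁, Chain.IsIsomorphic (S.mapIso e) X.chain Y.chain e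

variable [Preadditive A]

/-- The left rotation `X₂ ⟶ ⋯ ⟶ Xₙ ⟶ S X₁ ⟶ S X₂`, the last morphism being `(-1)ⁿ S α₁`. -/
def rotate (X : NSeq S n) : NSeq S n where
  X₁ := X.chain.second
  chain := X.chain.tailSnoc (((-1 : ℤ) ^ n) • S.map X.chain.head)

/-- The trivial sequence `X ⟶ X ⟶ 0 ⟶ ⋯ ⟶ 0 ⟶ S X` that starts with the identity. -/
def trivial [HasZeroObject A] (S : A ⥤ A) : (n : ℕ) → 2 ≤ n → A → NSeq S n
  | k + 2, _, X => ⟨X, Chain.cons (𝟙 X) (Chain.zeros (S.obj X) k X)⟩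

/-- The direct sum of two `n`-`S`-sequences. -/
def sum [HasBinaryBiproducts A] (X Y : NSeq S n) : NSeq S n where
  X₁ := X.X₁ ⊞ Y.X₁
  chain := Chain.sum (S.map biprod.inl) (S.map biprod.inr) X.chain Y.chain

/-- The cone `X₂ ⊞ Y₁ ⟶ X₃ ⊞ Y₂ ⟶ ⋯ ⟶ S X₁ ⊞ Yₙ ⟶ S (X₂ ⊞ Y₁)` of a morphism of
`n`-`S`-sequences. The components of the last morphism are, after the identification of
`S (X₂ ⊞ Y₁)` with `S X₂ ⊞ S Y₁`: `-S α₁`, `S φ₁`, `0` and `βₙ`. -/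
def Hom.cone [HasBinaryBiproducts A] {X Y : NSeq S n} {φ₁ : X.X₁ ⟶ Y.X₁}
    (φ : NSeq.Hom X Y φ₁) : NSeq S n where
  X₁ := X.chain.second ⊞ Y.X₁
  chain := Chain.Hom.cone
    (-(S.map X.chain.head ≫ S.map biprod.inl) + S.map φ₁ ≫ S.map biprod.inr)
    (S.map biprod.inr) φ

end NSeq

/-- The axioms (F1), (F2), (F3), (F4) of an `n`-angulation of `(A, S)`. -/
structure IsNAngulation {A : Type u} [Category.{v} A] [Preadditive A] [HasZeroObject A]
    [HasBinaryBiproducts A] (S : A ⥤ A) (n : ℕ) (hn : 3 ≤ n) (angles : Set (NSeq S n)) :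
    Prop where
  F1_sum : ∀ X ∈ angles, ∀ Y ∈ angles, X.sum Y ∈ angles
  F1_summand : ∀ X Y Z : NSeq S n, Z ∈ angles → Z.IsIsomorphic (X.sum Y) → X ∈ angles
  F1_trivial : ∀ X : A, NSeq.trivial S n (le_trans (by decide) hn) X ∈ angles
  F1_exists : ∀ {X₁ X₂ : A} (α₁ : X₁ ⟶ X₂),
    ∃ c : Chain (S.obj X₁) n X₁, c.StartsWith α₁ ∧ NSeq.mk X₁ c ∈ angles
  F2 : ∀ X : NSeq S n, X ∈ angles ↔ X.rotate ∈ angles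
  F3 : ∀ X ∈ angles, ∀ Y ∈ angles, ∀ (φ₁ : X.X₁ ⟶ Y.X₁)
    (φ₂ : X.chain.second ⟶ Y.chain.second), X.chain.head ≫ φ₂ = φ₁ ≫ Y.chain.head →
      ∃ φ : NSeq.Hom X Y φ₁, φ.second = φ₂
  F4 : ∀ X ∈ angles, ∀ Y ∈ angles, ∀ (φ₁ : X.X₁ ⟶ Y.X₁)
    (φ₂ : X.chain.second ⟶ Y.chain.second), X.chain.head ≫ φ₂ = φ₁ ≫ Y.chain.head →
      ∃ φ : NSeq.Hom X Y φ₁, φ.second = φ₂ ∧ NSeq.Hom.cone φ ∈ angles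

/-- `(A, S, angles)` is an `n`-angulated category: `A` is additive, `S` is an autoequivalence
of `A`, and `angles` is an `n`-angulation of `(A, S)`. -/
structure IsNAngulatedCategory (A : Type u) [Category.{v} A] [Preadditive A] (S : A ⥤ A)
    (n : ℕ) (hn : 3 ≤ n) (angles : Set (NSeq S n)) : Prop where
  [hasZeroObject : HasZeroObject A]
  [hasBinaryBiproducts : HasBinaryBiproducts A]
  isEquivalence : S.IsEquivalence
  isNAngulation : IsNAngulation S n hn angles

/-- Every object has a right approximation by an object of `P`. -/
def IsContravariantlyFinite {C : Type u} [Category.{v} C] (P : ObjectProperty C) : Prop :=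
  ∀ X : C, ∃ (F : C) (p : F ⟶ X), P F ∧ ∀ (G : C), P G → ∀ g : G ⟶ X, ∃ h : G ⟶ F, h ≫ p = g

/-- Every object has a left approximation by an object of `P`. -/
def IsCovariantlyFinite {C : Type u} [Category.{v} C] (P : ObjectProperty C) : Prop :=
  ∀ X : C, ∃ (F : C) (i : X ⟶ F), P F ∧ ∀ (G : C), P G → ∀ g : X ⟶ G, ∃ h : F ⟶ G, i ≫ h = g

/-- The full subcategory on the objects with `P` is `d`-cluster tilting: it is functorially
finite and equal to its right and to its left orthogonal with respect to
`Hom(-, Σⁱ -)`, `0 < i < d`. -/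
structure IsClusterTilting {C : Type u} [Category.{v} C] [Preadditive C] [HasShift C ℤ]
    (d : ℕ) (P : ObjectProperty C) : Prop where
  contravariantlyFinite : IsContravariantlyFinite P
  covariantlyFinite : IsCovariantlyFinite P
  iff_right : ∀ X : C, P X ↔
    ∀ F : C, P F → ∀ i : ℕ, 0 < i → i < d → ∀ f : F ⟶ X⟦(i : ℤ)⟧, f = 0
  iff_left : ∀ X : C, P X ↔
    ∀ F : C, P F → ∀ i : ℕ, 0 < i → i < d → ∀ f : X ⟶ F⟦(i : ℤ)⟧, f = 0

/-- The functor `Σᵈ` restricted to a full subcategory that is closed under it. -/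
abbrev restrictedShift {C : Type u} [Category.{v} C] [HasShift C ℤ] (P : ObjectProperty C)
    (d : ℤ) (hP : ∀ X : C, P X → P (X⟦d⟧)) : P.FullSubcategory ⥤ P.FullSubcategory :=
  P.lift (P.ι ⋙ shiftFunctor C d) (fun X => hP X.obj X.property)

section

variable {C : Type u} [Category.{v} C] [Preadditive C] [HasZeroObject C] [HasShift C ℤ]
  [∀ m : ℤ, (shiftFunctor C m).Additive] [Pretriangulated C]

/-- `IsSpliced t c`, for a morphism `t : U⟦d⟧ ⟶ W` and a chain
`c : U ⟶ Xᵢ ⟶ Xᵢ₊₁ ⟶ ⋯ ⟶ Xₙ ⟶ W`, says that `U ⟶ Xᵢ ⟶ ⋯ ⟶ Xₙ` is obtained by splicing `d`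
distinguished triangles, where `d` is the number of the objects `Xᵢ, …, Xₙ₋₁`, and that
`Xₙ ⟶ W` is the composition `Xₙ ⟶ ⋯ ⟶ U⟦d⟧` of the shifted connecting morphisms of these
triangles, followed by `t`:
* for `d = 1` there is a distinguished triangle `U ⟶ Xₙ₋₁ ⟶ Xₙ ⟶ U⟦1⟧`;
* for `d > 1` there are a distinguished triangle `U ⟶ Xᵢ ⟶ V ⟶ U⟦1⟧` and a factorization
  `Xᵢ ⟶ V ⟶ Xᵢ₊₁`, and `V ⟶ Xᵢ₊₁ ⟶ ⋯ ⟶ Xₙ` is in turn obtained by splicing `d - 1`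
  distinguished triangles; here `t` is replaced by `V⟦d - 1⟧ ⟶ U⟦1⟧⟦d - 1⟧ ≅ U⟦d⟧ ⟶ W`. -/
inductive IsSpliced {W : C} :
    {d : ℤ} → {n : ℕ} → {U : C} → (U⟦d⟧ ⟶ W) → Chain W n U → Prop
  | triangle {U X Y : C} (f : U ⟶ X) (g : X ⟶ Y) (h : Y ⟶ U⟦(1 : ℤ)⟧)
      (hT : Triangle.mk f g h ∈ distTriang C) (t : U⟦(1 : ℤ)⟧ ⟶ W) (α : Y ⟶ W)
      (hα : h ≫ t = α) :
      IsSpliced t (Chain.cons f (Chain.cons g (Chain.single α)))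
  | splice {U X V Y : C} {d d' : ℤ} (hd : 1 + d = d') {k : ℕ} (f : U ⟶ X) (p : X ⟶ V)
      (h : V ⟶ U⟦(1 : ℤ)⟧) (hT : Triangle.mk f p h ∈ distTriang C) (q : V ⟶ Y) (g : X ⟶ Y)
      (hg : p ≫ q = g) (c : Chain W k Y) (t : U⟦d'⟧ ⟶ W)
      (hc : IsSpliced (d := d) (h⟦d⟧' ≫ (shiftFunctorAdd' C 1 d d' hd).inv.app U ≫ t)
        (Chain.cons q c)) :
      IsSpliced t (Chain.cons f (Chain.cons g c))

/-- The standard `n`-angles: the sequences `X₁ ⟶ ⋯ ⟶ Xₙ ⟶ Σᵈ X₁` in the full subcategory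
that arise by splicing distinguished triangles of the ambient category, the last morphism
being the composition of the shifted connecting morphisms. -/
def standardAngles (P : ObjectProperty C) (d : ℤ) (hP : ∀ X : C, P X → P (X⟦d⟧)) (n : ℕ) :
    Set (NSeq (restrictedShift P d hP) n) :=
  { X | IsSpliced (𝟙 (X.X₁.obj⟦d⟧)) (X.chain.map P.ι) }

end

end HigherAngulated

end

/-! The axioms are proved by induction on the number of spliced triangles. `SplK c κ` records a
chain c : U ⟶ ⋯ ⟶ Z together with its total connecting morphism κ : Z ⟶ U⟦d⟧. The induction starts
at d = 0, where the chain is an isomorphism U ≅ Z. The intermediate objects ("cosyzygies") are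
arbitrary objects of the triangulated category. By `snoc_mem_standardAngles_iff`, an n-angle is such
a chain over X₁ in degree n - 2, extended by κ.

Rotation needs no cluster tilting: each triangle is moved by one octahedron (`SplK.rotate`,
`SplK.exists_unrotate`).

Existence uses left approximations. The cone V of α₁ has Hom(V, F⟦j⟧) = 0 for 1 < j < n - 2. Passing
to the cone of a left approximation raises the only possibly nonzero degree by one. Once it leaves
the range, the object lies in F (`IsClusterTilting.exists_coresolution`).

For (F4) the cone is built first and φ is read off from it. X₂ ⊞ Y₁ is a split extension of X₂ by
Y₁. Inductively, an extension N of cosyzygies M by P maps to X ⊞ Q, and its cone N' is an extension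
of M' by P' (`exists_horseshoe`). To continue, P' ⟶ Q' must extend to N'. The obstruction lies in
Hom(M', Q'⟦1⟧), where κ detects morphisms (`SplK.eq_zero_of_comp_eq_zero`). It vanishes because κ
lifts, up to sign, to N'. The squares of φ commute because consecutive differentials of the cone
compose to zero. (F3) is a weakening of (F4).

Sums of distinguished triangles are distinguished. For summands, closure of F under Σᵈ gives Hom(F,
F⟦j⟧) = 0 for -d < j < 0. This makes factorizations through cosyzygies unique, so a retract of a
spliced sequence can be spliced step by step (`SplK.retract`). The last triangle is handled by
`dist_of_retract`. -/

noncomputable section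

namespace HigherAngulated

/-! ### Triangles: retracts, sums and the horseshoe lemma. -/

section Triangles

variable {C : Type u} [Category.{v} C] [Preadditive C] [HasZeroObject C] [HasShift C ℤ]
  [∀ m : ℤ, (shiftFunctor C m).Additive] [Pretriangulated C]

section

variable {X Y Z : C} {f : X ⟶ Y} {g : Y ⟶ Z} {h : Z ⟶ X⟦(1 : ℤ)⟧}

lemma dist_zero₁₂ (hT : Triangle.mk f g h ∈ distTriang C) : f ≫ g = 0 :=
  comp_distTriang_mor_zero₁₂ _ hT

lemma dist_zero₂₃ (hT : Triangle.mk f g h ∈ distTriang C) : g ≫ h = 0 :=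
  comp_distTriang_mor_zero₂₃ _ hT

lemma dist_zero₃₁ (hT : Triangle.mk f g h ∈ distTriang C) : h ≫ f⟦(1 : ℤ)⟧' = 0 :=
  comp_distTriang_mor_zero₃₁ _ hT

lemma dist_rotate_iff :
    Triangle.mk f g h ∈ distTriang C ↔ Triangle.mk g h (-f⟦(1 : ℤ)⟧') ∈ distTriang C :=
  rotate_distinguished_triangle _

lemma dist_yoneda₃ (hT : Triangle.mk f g h ∈ distTriang C) {A : C} (a : Z ⟶ A)
    (ha : g ≫ a = 0) : ∃ b : X⟦(1 : ℤ)⟧ ⟶ A, a = h ≫ b :=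
  Triangle.yoneda_exact₃ _ hT a ha

lemma dist_coyoneda₂ (hT : Triangle.mk f g h ∈ distTriang C) {A : C} (a : A ⟶ Y)
    (ha : a ≫ g = 0) : ∃ b : A ⟶ X, a = b ≫ f :=
  Triangle.coyoneda_exact₂ _ hT a ha

variable {X' Y' Z' : C} {f' : X' ⟶ Y'} {g' : Y' ⟶ Z'} {h' : Z' ⟶ X'⟦(1 : ℤ)⟧}

lemma dist_complete₃ (hT : Triangle.mk f g h ∈ distTriang C)
    (hT' : Triangle.mk f' g' h' ∈ distTriang C) (a : X ⟶ X') (b : Y ⟶ Y')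
    (w : f ≫ b = a ≫ f') : ∃ c : Z ⟶ Z', g ≫ c = b ≫ g' ∧ h ≫ a⟦(1 : ℤ)⟧' = c ≫ h' :=
  complete_distinguished_triangle_morphism _ _ hT hT' a b w

lemma dist_of_iso (hT : Triangle.mk f g h ∈ distTriang C) (a : X ≅ X') (b : Y ≅ Y')
    (c : Z ≅ Z') (w₁ : f ≫ b.hom = a.hom ≫ f') (w₂ : g ≫ c.hom = b.hom ≫ g')
    (w₃ : h ≫ a.hom⟦(1 : ℤ)⟧' = c.hom ≫ h') : Triangle.mk f' g' h' ∈ distTriang C :=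
  (distinguished_iff_of_iso (Triangle.isoMk (Triangle.mk f g h) (Triangle.mk f' g' h')
    a b c w₁ w₂ w₃)).mp hT

lemma isIso_of_dist {U V W : C} {a : U ⟶ V} {b : V ⟶ W} {c : W ⟶ U⟦(1 : ℤ)⟧} {W' : C}
    {b' : V ⟶ W'} {c' : W' ⟶ U⟦(1 : ℤ)⟧} (hT : Triangle.mk a b c ∈ distTriang C)
    (hT' : Triangle.mk a b' c' ∈ distTriang C) (e : W ⟶ W') (w₂ : b ≫ e = b')
    (w₃ : e ≫ c' = c) : IsIso e := by
  let φ : Triangle.mk a b c ⟶ Triangle.mk a b' c' :=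
    { hom₁ := 𝟙 U
      hom₂ := 𝟙 V
      hom₃ := e
      comm₁ := (Category.comp_id a).trans (Category.id_comp a).symm
      comm₂ := w₂.trans (Category.id_comp b').symm
      comm₃ := by
        have : c ≫ (𝟙 U)⟦(1 : ℤ)⟧' = e ≫ c' := by rw [CategoryTheory.Functor.map_id, Category.comp_id, w₃]
        exact this }
  exact isIso₃_of_isIso₁₂ φ hT hT' (inferInstanceAs (IsIso (𝟙 U))) (inferInstanceAs (IsIso (𝟙 V)))

end

/-- A candidate triangle that is related in both directions to a distinguished triangle on the
same first morphism is distinguished, if it is exact at its third object. -/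
lemma dist_of_comparison {U X Y V : C} {f : U ⟶ X} {g : X ⟶ Y} {h : Y ⟶ U⟦(1 : ℤ)⟧}
    {p : X ⟶ V} {k : V ⟶ U⟦(1 : ℤ)⟧} (hT : Triangle.mk f p k ∈ distTriang C)
    (ψ : V ⟶ Y) (hψ₁ : p ≫ ψ = g) (hψ₂ : ψ ≫ h = k)
    (χ : Y ⟶ V) (hχ₁ : g ≫ χ = p) (hχ₂ : χ ≫ k = h)
    (ex : ∀ η : Y ⟶ Y, g ≫ η = 0 → ∃ σ : U⟦(1 : ℤ)⟧ ⟶ Y, η = h ≫ σ) :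
    Triangle.mk f g h ∈ distTriang C := by
  have i₁ : IsIso (ψ ≫ χ) := isIso_of_dist hT hT _ (by rw [reassoc_of% hψ₁, hχ₁])
    (by rw [Category.assoc, hχ₂, hψ₂])
  -- The endomorphism η = χ ≫ ψ - 1 factors as h ≫ σ and satisfies η ≫ h = 0, so η² = 0. Hence 1 -
  -- η, written `2 • 𝟙 Y - χ ≫ ψ` below, inverts χ ≫ ψ.
  obtain ⟨σ, hσ⟩ := ex (χ ≫ ψ - 𝟙 Y) (by
    rw [Preadditive.comp_sub, reassoc_of% hχ₁, hψ₁, Category.comp_id, sub_self])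
  have hη : (χ ≫ ψ - 𝟙 Y) ≫ h = 0 := by
    rw [Preadditive.sub_comp, Category.assoc, hψ₂, hχ₂, Category.id_comp, sub_self]
  have hsq : (χ ≫ ψ - 𝟙 Y) ≫ (χ ≫ ψ - 𝟙 Y) = 0 := by
    conv_lhs => arg 2; rw [hσ]
    rw [reassoc_of% hη, zero_comp]
  have hs : (2 • 𝟙 Y - χ ≫ ψ) ≫ χ ≫ ψ = 𝟙 Y := by
    have : (2 • 𝟙 Y - χ ≫ ψ) ≫ χ ≫ ψ = 𝟙 Y - (χ ≫ ψ - 𝟙 Y) ≫ (χ ≫ ψ - 𝟙 Y) := by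
      simp only [Preadditive.comp_sub, Preadditive.sub_comp, Category.comp_id, Category.id_comp,
        Preadditive.nsmul_comp]
      abel
    rw [this, hsq, sub_zero]
  have : IsSplitEpi ψ := ⟨⟨(2 • 𝟙 Y - χ ≫ ψ) ≫ χ, by rw [Category.assoc, hs]⟩⟩
  have : Mono ψ := mono_of_mono ψ χ
  have : IsIso ψ := isIso_of_mono_of_isSplitEpi ψ
  exact dist_of_iso hT (Iso.refl _) (Iso.refl _) (asIso ψ)
    (by simp) (by simp [hψ₁]) (by simp [hψ₂])

/-- A retract of a distinguished triangle is distinguished. -/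
lemma dist_of_retract {U X Y U' X' Y' : C} {f : U ⟶ X} {g : X ⟶ Y} {h : Y ⟶ U⟦(1 : ℤ)⟧}
    {f' : U' ⟶ X'} {g' : X' ⟶ Y'} {h' : Y' ⟶ U'⟦(1 : ℤ)⟧}
    (hT' : Triangle.mk f' g' h' ∈ distTriang C)
    {i₁ : U ⟶ U'} {i₂ : X ⟶ X'} {i₃ : Y ⟶ Y'} {r₁ : U' ⟶ U} {r₂ : X' ⟶ X} {r₃ : Y' ⟶ Y}
    (ir₁ : i₁ ≫ r₁ = 𝟙 U) (ir₂ : i₂ ≫ r₂ = 𝟙 X) (ir₃ : i₃ ≫ r₃ = 𝟙 Y)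
    (wi₁ : f ≫ i₂ = i₁ ≫ f') (wi₂ : g ≫ i₃ = i₂ ≫ g') (wi₃ : h ≫ i₁⟦(1 : ℤ)⟧' = i₃ ≫ h')
    (wr₁ : f' ≫ r₂ = r₁ ≫ f) (wr₂ : g' ≫ r₃ = r₂ ≫ g) (wr₃ : h' ≫ r₁⟦(1 : ℤ)⟧' = r₃ ≫ h) :
    Triangle.mk f g h ∈ distTriang C := by
  obtain ⟨V, p, k, hT⟩ := distinguished_cocone_triangle f
  obtain ⟨ψ, hψ₁, hψ₂⟩ := dist_complete₃ hT hT' i₁ i₂ wi₁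
  obtain ⟨χ, hχ₁, hχ₂⟩ := dist_complete₃ hT' hT r₁ r₂ wr₁
  have ir₁' : i₁⟦(1 : ℤ)⟧' ≫ r₁⟦(1 : ℤ)⟧' = 𝟙 _ := by
    rw [← Functor.map_comp, ir₁, CategoryTheory.Functor.map_id]
  -- Both comparison maps pass through Y', and exactness at Y is inherited from the larger triangle.
  refine dist_of_comparison hT (ψ ≫ r₃) ?_ ?_ (i₃ ≫ χ) ?_ ?_ ?_
  · rw [reassoc_of% hψ₁, wr₂, reassoc_of% ir₂]
  · rw [Category.assoc, ← wr₃, ← reassoc_of% hψ₂, ir₁', Category.comp_id]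
  · rw [reassoc_of% wi₂, hχ₁, reassoc_of% ir₂]
  · rw [Category.assoc, ← hχ₂, ← reassoc_of% wi₃, ir₁', Category.comp_id]
  · intro η hη
    obtain ⟨σ, hσ⟩ := dist_yoneda₃ hT' (r₃ ≫ η) (by rw [reassoc_of% wr₂, hη, comp_zero])
    exact ⟨i₁⟦(1 : ℤ)⟧' ≫ σ, by rw [reassoc_of% wi₃, ← hσ, reassoc_of% ir₃]⟩

/-- The maps of a biproduct decomposition of `B` into `X` and `Y`. -/
structure SumData {A : Type u'} [Category.{v'} A] [Preadditive A] (X Y B : A) where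
  inl : X ⟶ B
  inr : Y ⟶ B
  fst : B ⟶ X
  snd : B ⟶ Y
  inl_fst : inl ≫ fst = 𝟙 X := by cat_disch
  inl_snd : inl ≫ snd = 0 := by cat_disch
  inr_fst : inr ≫ fst = 0 := by cat_disch
  inr_snd : inr ≫ snd = 𝟙 Y := by cat_disch
  total : fst ≫ inl + snd ≫ inr = 𝟙 B := by cat_disch

namespace SumData

attribute [simp] inl_fst inl_snd inr_fst inr_snd total

variable {A : Type u'} [Category.{v'} A] [Preadditive A]

section

variable {X Y B : A} (S : SumData X Y B)

@[simp]
lemma inl_fst_assoc {W : A} (h : X ⟶ W) : S.inl ≫ S.fst ≫ h = h := by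
  rw [← Category.assoc, S.inl_fst, Category.id_comp]

@[simp]
lemma inl_snd_assoc {W : A} (h : Y ⟶ W) : S.inl ≫ S.snd ≫ h = 0 ≫ h := by
  rw [← Category.assoc, S.inl_snd]

@[simp]
lemma inr_fst_assoc {W : A} (h : X ⟶ W) : S.inr ≫ S.fst ≫ h = 0 ≫ h := by
  rw [← Category.assoc, S.inr_fst]

@[simp]
lemma inr_snd_assoc {W : A} (h : Y ⟶ W) : S.inr ≫ S.snd ≫ h = h := by
  rw [← Category.assoc, S.inr_snd, Category.id_comp]

end

/-- The biproduct of two objects. -/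
@[simps]
def ofBiprod [HasBinaryBiproducts A] (X Y : A) : SumData X Y (X ⊞ Y) where
  inl := Limits.biprod.inl
  inr := Limits.biprod.inr
  fst := Limits.biprod.fst
  snd := Limits.biprod.snd

/-- The image of a biproduct decomposition under an additive functor. -/
@[simps]
def map {B : Type u} [Category.{v} B] [Preadditive B] (G : A ⥤ B) [G.Additive] {X Y Z : A}
    (S : SumData X Y Z) : SumData (G.obj X) (G.obj Y) (G.obj Z) where
  inl := G.map S.inl
  inr := G.map S.inr
  fst := G.map S.fst
  snd := G.map S.snd
  inl_fst := by rw [← G.map_comp, S.inl_fst, G.map_id]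
  inl_snd := by rw [← G.map_comp, S.inl_snd, G.map_zero]
  inr_fst := by rw [← G.map_comp, S.inr_fst, G.map_zero]
  inr_snd := by rw [← G.map_comp, S.inr_snd, G.map_id]
  total := by rw [← G.map_comp, ← G.map_comp, ← G.map_add, S.total, G.map_id]

variable {X Y Z : A} (S : SumData X Y Z)

lemma hom_ext_src {W : A} {a b : Z ⟶ W} (h₁ : S.inl ≫ a = S.inl ≫ b)
    (h₂ : S.inr ≫ a = S.inr ≫ b) : a = b := by
  rw [← Category.id_comp a, ← Category.id_comp b, ← S.total]
  simp only [Preadditive.add_comp, Category.assoc, h₁, h₂]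

lemma hom_ext_tgt {W : A} {a b : W ⟶ Z} (h₁ : a ≫ S.fst = b ≫ S.fst)
    (h₂ : a ≫ S.snd = b ≫ S.snd) : a = b := by
  rw [← Category.comp_id a, ← Category.comp_id b, ← S.total]
  simp only [Preadditive.comp_add, reassoc_of% h₁, reassoc_of% h₂]

end SumData

/-- A direct sum of distinguished triangles is distinguished. -/
lemma dist_sum {U X Y U' X' Y' U'' X'' Y'' : C} {f : U ⟶ X} {g : X ⟶ Y} {h : Y ⟶ U⟦(1 : ℤ)⟧}
    {f' : U' ⟶ X'} {g' : X' ⟶ Y'} {h' : Y' ⟶ U'⟦(1 : ℤ)⟧}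
    (hT : Triangle.mk f g h ∈ distTriang C) (hT' : Triangle.mk f' g' h' ∈ distTriang C)
    (S₁ : SumData U U' U'') (S₂ : SumData X X' X'') (S₃ : SumData Y Y' Y'') :
    Triangle.mk (S₁.fst ≫ f ≫ S₂.inl + S₁.snd ≫ f' ≫ S₂.inr)
      (S₂.fst ≫ g ≫ S₃.inl + S₂.snd ≫ g' ≫ S₃.inr)
      (S₃.fst ≫ h ≫ S₁.inl⟦(1 : ℤ)⟧' + S₃.snd ≫ h' ≫ S₁.inr⟦(1 : ℤ)⟧') ∈ distTriang C := by
  obtain ⟨V, p, k, hV⟩ :=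
    distinguished_cocone_triangle (S₁.fst ≫ f ≫ S₂.inl + S₁.snd ≫ f' ≫ S₂.inr)
  obtain ⟨a, ha₁, ha₂⟩ := dist_complete₃ hT hV S₁.inl S₂.inl (by simp)
  obtain ⟨a', ha₁', ha₂'⟩ := dist_complete₃ hT' hV S₁.inr S₂.inr (by simp)
  obtain ⟨b, hb₁, hb₂⟩ := dist_complete₃ hV hT S₁.fst S₂.fst (by simp)
  obtain ⟨b', hb₁', hb₂'⟩ := dist_complete₃ hV hT' S₁.snd S₂.snd (by simp)
  let S₀ := S₁.map (shiftFunctor C (1 : ℤ))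
  refine dist_of_comparison hV (b ≫ S₃.inl + b' ≫ S₃.inr) ?_ ?_ (S₃.fst ≫ a + S₃.snd ≫ a') ?_ ?_ ?_
  · simp [reassoc_of% hb₁, reassoc_of% hb₁']
  · simp only [Preadditive.add_comp, Preadditive.comp_add, Category.assoc, S₃.inl_fst_assoc,
      S₃.inr_fst_assoc, S₃.inl_snd_assoc, S₃.inr_snd_assoc, zero_comp, comp_zero, add_zero,
      zero_add, ← reassoc_of% hb₂, ← reassoc_of% hb₂']
    rw [← Preadditive.comp_add]
    exact (k ≫= S₀.total).trans (Category.comp_id _)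
  · simp [ha₁, ha₁']
    rw [← Category.assoc, ← Category.assoc, ← Preadditive.add_comp, S₂.total, Category.id_comp]
  · simp [ha₂, ha₂']
  · intro η hη
    have e₁ := S₂.inl ≫= hη
    have e₂ := S₂.inr ≫= hη
    simp at e₁ e₂
    obtain ⟨σ, hσ⟩ := dist_yoneda₃ hT (S₃.inl ≫ η) e₁
    obtain ⟨σ', hσ'⟩ := dist_yoneda₃ hT' (S₃.inr ≫ η) e₂
    refine ⟨S₀.fst ≫ σ + S₀.snd ≫ σ', S₃.hom_ext_src ?_ ?_⟩
    · have z₁ : S₁.inl⟦(1 : ℤ)⟧' ≫ S₀.fst = 𝟙 _ := S₀.inl_fst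
      have z₂ : S₁.inl⟦(1 : ℤ)⟧' ≫ S₀.snd = 0 := S₀.inl_snd
      simp [hσ, reassoc_of% z₁, reassoc_of% z₂]
    · have z₁ : S₁.inr⟦(1 : ℤ)⟧' ≫ S₀.fst = 0 := S₀.inr_fst
      have z₂ : S₁.inr⟦(1 : ℤ)⟧' ≫ S₀.snd = 𝟙 _ := S₀.inr_snd
      simp [hσ', reassoc_of% z₁, reassoc_of% z₂]

section

variable [IsTriangulated C]

/-- A morphism out of the middle of a distinguished triangle gives a homotopy pushout. -/
lemma exists_homotopy_pushout {P Q P' M N : C} {f : P ⟶ Q} {p : Q ⟶ P'} {h : P' ⟶ P⟦(1 : ℤ)⟧}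
    (hP : Triangle.mk f p h ∈ distTriang C) {i : P ⟶ N} {π : N ⟶ M} {δ : M ⟶ P⟦(1 : ℤ)⟧}
    (hN : Triangle.mk i π δ ∈ distTriang C) (y : N ⟶ Q) (hy : i ≫ y = f) :
    ∃ g : Q ⊞ M ⟶ P', biprod.inl ≫ g = p ∧
      Triangle.mk (biprod.lift y π) g (h ≫ i⟦(1 : ℤ)⟧') ∈ distTriang C := by
  obtain ⟨K, v, w, hK⟩ := distinguished_cocone_triangle (biprod.lift y π)
  have hQ : Triangle.mk (biprod.snd : Q ⊞ M ⟶ M) (0 : M ⟶ Q⟦(1 : ℤ)⟧)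
      (-(biprod.inl : Q ⟶ Q ⊞ M)⟦(1 : ℤ)⟧') ∈ distTriang C :=
    dist_rotate_iff.mp (binaryBiproductTriangle_distinguished Q M)
  -- The octahedron on N ⟶ Q ⊞ M ⟶ M yields K ⟶ P⟦1⟧ ⟶ Q⟦1⟧ with second morphism f⟦1⟧, so K is
  -- another cone of f.
  let o := Triangulated.someOctahedron (biprod.lift_snd y π) hK hQ (dist_rotate_iff.mp hN)
  have o₁ : v ≫ o.m₁ = biprod.snd ≫ δ := o.comm₁
  have o₂ : o.m₁ ≫ (-i⟦(1 : ℤ)⟧') = w := o.comm₂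
  have o₄ : (-i⟦(1 : ℤ)⟧') ≫ (biprod.lift y π)⟦(1 : ℤ)⟧' = o.m₃ ≫ (-biprod.inl⟦(1 : ℤ)⟧') := o.comm₄
  have m₃ : o.m₃ = f⟦(1 : ℤ)⟧' := by
    have := o₄ =≫ biprod.fst⟦(1 : ℤ)⟧'
    simp only [Category.assoc, Preadditive.neg_comp, Preadditive.comp_neg, neg_inj,
      ← Functor.map_comp, biprod.lift_fst, biprod.inl_fst, hy] at this
    rw [this, CategoryTheory.Functor.map_id, Category.comp_id]
  have om : Triangle.mk o.m₁ o.m₃ ((-biprod.inl⟦(1 : ℤ)⟧') ≫ v⟦(1 : ℤ)⟧') ∈ distTriang C := o.mem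
  rw [m₃, Preadditive.neg_comp, ← Functor.map_comp] at om
  have hK' := dist_rotate_iff.mpr om
  have hP' := dist_rotate_iff.mp hP
  obtain ⟨e, he₁, he₂⟩ : ∃ e : K ≅ P', (biprod.inl ≫ v) ≫ e.hom = p ∧ o.m₁ = -(e.hom ≫ h) := by
    -- The third morphisms f⟦1⟧ and -f⟦1⟧ of the two triangles differ by a sign, which -1 on P⟦1⟧
    -- absorbs.
    let e := isoTriangleOfIso₁₃ _ _ hK' hP' (Iso.refl Q) (-Iso.refl _) (by
      change f⟦(1 : ℤ)⟧' ≫ (𝟙 Q)⟦(1 : ℤ)⟧' = (-𝟙 _) ≫ (-f⟦(1 : ℤ)⟧')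
      simp)
    obtain ⟨e', e₁, e₂⟩ : ∃ e' : K ≅ P', (biprod.inl ≫ v) ≫ e'.hom = 𝟙 Q ≫ p ∧
        o.m₁ ≫ (-𝟙 (P⟦(1 : ℤ)⟧)) = e'.hom ≫ h :=
      ⟨Triangle.π₂.mapIso e, e.hom.comm₁, e.hom.comm₂⟩
    refine ⟨e', e₁.trans (Category.id_comp p), ?_⟩
    rw [← e₂, Preadditive.comp_neg, Category.comp_id, neg_neg]
  refine ⟨v ≫ e.hom, by rw [← he₁, Category.assoc], ?_⟩
  refine dist_of_iso hK (Iso.refl _) (Iso.refl _) e (by simp) (by simp) ?_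
  rw [← o₂, he₂]
  simp

/-- The horseshoe lemma: an extension `N` of `M` by `P`, with a morphism to `Q` that extends
`P ⟶ Q`, maps to the biproduct `B` of `X` and `Q`, and the cone is an extension of the cones. -/
lemma exists_horseshoe {P Q P' M X M' N B : C} {f' : P ⟶ Q} {p' : Q ⟶ P'} {h' : P' ⟶ P⟦(1 : ℤ)⟧}
    (hP : Triangle.mk f' p' h' ∈ distTriang C) {f : M ⟶ X} {p : X ⟶ M'} {h : M' ⟶ M⟦(1 : ℤ)⟧}
    (hM : Triangle.mk f p h ∈ distTriang C) {i : P ⟶ N} {π : N ⟶ M} {δ : M ⟶ P⟦(1 : ℤ)⟧}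
    (hN : Triangle.mk i π δ ∈ distTriang C) (y : N ⟶ Q) (hy : i ≫ y = f') (S : SumData X Q B) :
    ∃ (N' : C) (q : B ⟶ N') (k : N' ⟶ N⟦(1 : ℤ)⟧) (i' : P' ⟶ N') (π' : N' ⟶ M')
      (δ' : M' ⟶ P'⟦(1 : ℤ)⟧),
      Triangle.mk (π ≫ f ≫ S.inl + y ≫ S.inr) q k ∈ distTriang C ∧
      Triangle.mk i' π' δ' ∈ distTriang C ∧ S.inr ≫ q = p' ≫ i' ∧ q ≫ π' = S.fst ≫ p ∧
      i' ≫ k = h' ≫ i⟦(1 : ℤ)⟧' ∧ k ≫ π⟦(1 : ℤ)⟧' = π' ≫ h := by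
  obtain ⟨g, hg, hT⟩ := exists_homotopy_pushout hP hN y hy
  obtain ⟨N', q, k, hN'⟩ := distinguished_cocone_triangle (π ≫ f ≫ S.inl + y ≫ S.inr)
  -- The cone of f ⊕ 1 on M ⊕ Q is M' ⊕ 0, for which M' itself serves.
  let S₃ : SumData M' (0 : C) M' :=
    { inl := 𝟙 _, inr := 0, fst := 𝟙 _, snd := 0, inr_snd := (isZero_zero C).eq_of_src _ _ }
  let S₁ : SumData M Q (Q ⊞ M) :=
    { inl := biprod.inr, inr := biprod.inl, fst := biprod.snd, snd := biprod.fst,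
      total := by rw [add_comm]; exact biprod.total }
  have h₂₃ := dist_sum hM (contractible_distinguished Q) S₁ S S₃
  have comm : biprod.lift y π ≫ (S₁.fst ≫ f ≫ S.inl + S₁.snd ≫ 𝟙 Q ≫ S.inr) =
      π ≫ f ≫ S.inl + y ≫ S.inr := by simp [S₁]
  -- N ⟶ B factors as (y, π), with cone P' by the homotopy pushout, followed by f ⊕ 1, with cone M'.
  let o := Triangulated.someOctahedron comm hT h₂₃ hN'
  have o₁ := o.comm₁
  have o₂ := o.comm₂
  have o₃ := o.comm₃
  have o₄ := o.comm₄
  refine ⟨N', q, k, o.m₁, o.m₃, _, hN', o.mem, ?_, ?_, ?_, ?_⟩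
  · rw [← hg, Category.assoc, o₁]
    simp [S₁]
  · simpa [S₃] using o₃
  · exact o₂
  · have := o₄ =≫ biprod.snd⟦(1 : ℤ)⟧'
    have z : (biprod.inr : M ⟶ Q ⊞ M)⟦(1 : ℤ)⟧' ≫ biprod.snd⟦(1 : ℤ)⟧' = 𝟙 (M⟦(1 : ℤ)⟧) := by
      rw [← Functor.map_comp, biprod.inr_snd, CategoryTheory.Functor.map_id]
    rw [Category.assoc, ← Functor.map_comp, biprod.lift_snd] at this
    rw [this]
    simp [S₁, S₃, z]

end

end Triangles

/-! ### Chains: precomposition and splitting off the last morphism. -/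

namespace Chain

section

variable {A : Type u} [Category.{v} A]

/-- Precompose the first morphism of a chain with a morphism. -/
def precomp {Z X' : A} : {n : ℕ} → {X : A} → (X' ⟶ X) → Chain Z n X → Chain Z n X'
  | _, _, p, single f => single (p ≫ f)
  | _, _, p, cons f c => cons (p ≫ f) c

@[simp]
lemma precomp_single {Z X X' : A} (p : X' ⟶ X) (f : X ⟶ Z) :
    precomp p (single f) = single (p ≫ f) := rfl

@[simp]
lemma precomp_cons {Z X X' Y : A} {n : ℕ} (p : X' ⟶ X) (f : X ⟶ Y) (c : Chain Z n Y) :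
    precomp p (cons f c) = cons (p ≫ f) c := rfl

@[simp]
lemma snoc_single {Z W X : A} (g : Z ⟶ W) (f : X ⟶ Z) :
    snoc g (single f) = cons f (single g) := rfl

@[simp]
lemma snoc_cons {Z W X Y : A} {n : ℕ} (g : Z ⟶ W) (f : X ⟶ Y) (c : Chain Z n Y) :
    snoc g (cons f c) = cons f (snoc g c) := rfl

lemma precomp_precomp {Z X X' X'' : A} {n : ℕ} (p : X'' ⟶ X') (q : X' ⟶ X) (c : Chain Z n X) :
    precomp p (precomp q c) = precomp (p ≫ q) c := by
  cases c <;> simp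

lemma snoc_precomp {Z W X X' : A} {n : ℕ} (g : Z ⟶ W) (p : X' ⟶ X) (c : Chain Z n X) :
    snoc g (precomp p c) = precomp p (snoc g c) := by
  cases c <;> rfl

/-- Strips a chain at both ends, which is needed to undo a rotation. The two ends do not interfere
because `c'` has at least two morphisms. -/
lemma exists_of_snoc_eq_precomp {Z W X X' : A} {n : ℕ} {g : Z ⟶ W} {p : X' ⟶ X}
    {c : Chain Z n X'} {c' : Chain W (n + 1) X} (h : snoc g c = precomp p c') :
    ∃ c'' : Chain Z n X, c' = snoc g c'' ∧ c = precomp p c'' := by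
  cases c with
  | single f =>
    cases c' with
    | cons f' c' =>
      simp only [snoc_single, precomp_cons] at h
      cases h
      exact ⟨single f', rfl, rfl⟩
  | cons f c =>
    cases c' with
    | cons f' c' =>
      simp only [snoc_cons, precomp_cons] at h
      cases h
      exact ⟨cons f' c, rfl, rfl⟩

lemma exists_eq_snoc {Z : A} {n : ℕ} {X : A} (c : Chain Z (n + 2) X) :
    ∃ (Y : A) (c' : Chain Y (n + 1) X) (g : Y ⟶ Z), c = snoc g c' := by
  induction n generalizing X with
  | zero =>
    obtain _ | ⟨f, c⟩ := c
    obtain g | ⟨_, c⟩ := c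
    · exact ⟨_, single f, g, rfl⟩
    · nomatch c
  | succ n ih =>
    obtain _ | ⟨f, c⟩ := c
    obtain ⟨Y, c', g, rfl⟩ := ih c
    exact ⟨Y, cons f c', g, rfl⟩

lemma map_snoc {B : Type u'} [Category.{v'} B] (G : A ⥤ B) {Z W : A} (g : Z ⟶ W) {n : ℕ} {X : A}
    (c : Chain Z n X) : map G (snoc g c) = snoc (G.map g) (map G c) := by
  induction c with
  | single f => rfl
  | cons f c ih => simp only [snoc_cons, map, ih]

end

end Chain

/-! ### Composition of shifted morphisms. -/

section

variable {C : Type u} [Category.{v} C] [HasShift C ℤ]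

lemma map_shift_comp {X Y Y' Z : C} {a b c : ℤ} (κ : ShiftedHom X Y a) (y : Y ⟶ Y')
    (g : ShiftedHom Y' Z b) (h : b + a = c) :
    ShiftedHom.comp (κ ≫ y⟦a⟧') g h = κ.comp (y ≫ g) h := by
  simp [ShiftedHom.comp]

lemma comp_map_shift {X Y Z Z' : C} {a b c : ℤ} (κ : ShiftedHom X Y a) (g : ShiftedHom Y Z b)
    (h : b + a = c) (z : Z ⟶ Z') : κ.comp g h ≫ z⟦c⟧' = κ.comp (g ≫ z⟦b⟧') h := by
  have := (shiftFunctorAdd' C b a c h).inv.naturality z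
  dsimp at this
  simp [ShiftedHom.comp, this]

lemma comp_id_shift {X Y : C} {a b c : ℤ} (κ : X ⟶ (Y⟦b⟧)⟦a⟧) (h : b + a = c) :
    ShiftedHom.comp (Y := Y⟦b⟧) (Z := Y) κ (𝟙 (Y⟦b⟧)) h =
      κ ≫ (shiftFunctorAdd' C b a c h).inv.app Y := by
  simp [ShiftedHom.comp]

/-- Compares connecting morphisms composed through the iterated shift Y⟦b⟧⟦a⟧ with those composed
through Y⟦c⟧, as needed in each rotation step. -/
lemma comp_map_shift_comp {X Y Y' Z : C} {a b b' c c' : ℤ} (κ : X ⟶ (Y⟦b⟧)⟦a⟧) (y : Y ⟶ Y')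
    (g : ShiftedHom Y' Z b') (h : b + a = c) (h' : b' + c = c') :
    ShiftedHom.comp (ShiftedHom.comp (Y := Y⟦b⟧) (Z := Y') κ (y⟦b⟧') h) g h' =
      ShiftedHom.comp (κ ≫ (shiftFunctorAdd' C b a c h).inv.app Y) (y ≫ g) h' := by
  rw [← map_shift_comp, ← comp_id_shift, comp_map_shift, Category.id_comp]

lemma mk₀_comp_map_shift {X Y Y' : C} (L : X ⟶ Y) (y : Y ⟶ Y') :
    ShiftedHom.mk₀ (0 : ℤ) rfl L ≫ y⟦(0 : ℤ)⟧' = ShiftedHom.mk₀ (0 : ℤ) rfl (L ≫ y) := by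
  rw [← ShiftedHom.comp_mk₀ _ 0 rfl, ShiftedHom.mk₀_comp_mk₀]

lemma mk₀_comp_of_eq {X Y Y' : C} {d : ℤ} (L : X ⟶ Y) (k : Y ⟶ Y'⟦(1 : ℤ)⟧) (hd : 1 + 0 = d)
    (N : C) (τ : Y'⟦d⟧ ⟶ N) : ShiftedHom.comp (ShiftedHom.mk₀ (0 : ℤ) rfl L) k hd ≫ τ =
      L ≫ k ≫ eqToHom (by rw [← hd, add_zero]) ≫ τ := by
  obtain rfl := (add_zero (1 : ℤ)).symm.trans hd
  rw [ShiftedHom.mk₀_comp]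
  simp

end

/-! ### Spliced sequences and their connecting morphisms. -/

section

variable {C : Type u} [Category.{v} C] [Preadditive C] [HasZeroObject C] [HasShift C ℤ]
  [∀ m : ℤ, (shiftFunctor C m).Additive] [Pretriangulated C]

/-- `SplK d c κ` says that the chain `c : U ⟶ ⋯ ⟶ Z` is obtained by splicing `d` distinguished
triangles, and that `κ : Z ⟶ U⟦d⟧` is the composition of their shifted connecting morphisms. -/
inductive SplK {Z : C} : {d : ℤ} → {k : ℕ} → {U : C} → Chain Z k U → ShiftedHom Z U d → Prop
  | base {U : C} (e : U ≅ Z) : SplK (Chain.single e.hom) (ShiftedHom.mk₀ (0 : ℤ) rfl e.inv)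
  | splice {U X V : C} {d d' : ℤ} (hd : 1 + d = d') {k : ℕ} (f : U ⟶ X) (p : X ⟶ V)
      (h : V ⟶ U⟦(1 : ℤ)⟧) (hT : Triangle.mk f p h ∈ distTriang C) (c : Chain Z k V)
      (κ : ShiftedHom Z V d) (hc : SplK c κ) :
      SplK (Chain.cons f (c.precomp p)) (κ.comp h hd)

namespace SplK

lemma exists_of_single {U Z : C} {d : ℤ} {q : U ⟶ Z} {κ : ShiftedHom Z U d}
    (hc : SplK (Chain.single q) κ) :
    ∃ (e : U ≅ Z) (hd : d = 0), q = e.hom ∧ κ = ShiftedHom.mk₀ d hd e.inv := by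
  cases hc with
  | base e => exact ⟨e, rfl, rfl, rfl⟩

lemma exists_of_cons {U X Z : C} {d' : ℤ} {k : ℕ} {f : U ⟶ X} {c : Chain Z k X}
    {κ : ShiftedHom Z U d'} (hc : SplK (Chain.cons f c) κ) :
    ∃ (V : C) (p : X ⟶ V) (h : V ⟶ U⟦(1 : ℤ)⟧) (d : ℤ) (hd : 1 + d = d') (c' : Chain Z k V)
      (κ' : ShiftedHom Z V d), Triangle.mk f p h ∈ distTriang C ∧ c = c'.precomp p ∧
        κ = κ'.comp h hd ∧ SplK c' κ' := by
  cases hc with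
  | splice hd f p h hT c κ hc => exact ⟨_, p, h, _, hd, c, κ, hT, rfl, rfl, hc⟩

/-- `IsSpliced` bottoms out at a triangle and `SplK` at an isomorphism. Keeping one triangle apart
lets it absorb that isomorphism in the base case. -/
lemma isSpliced_snoc_splice {Z V : C} {d : ℤ} {k : ℕ} {c : Chain Z k V} {κ : ShiftedHom Z V d}
    (hc : SplK c κ) {W U X : C} {d' : ℤ} (hd : 1 + d = d') (f : U ⟶ X) (p : X ⟶ V)
    (h : V ⟶ U⟦(1 : ℤ)⟧) (hT : Triangle.mk f p h ∈ distTriang C) (t : U⟦d'⟧ ⟶ W) :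
    IsSpliced t (Chain.snoc (κ.comp h hd ≫ t) (Chain.cons f (c.precomp p))) := by
  induction hc generalizing W U X d' with
  | base e =>
    obtain rfl : d' = 1 := by omega
    refine IsSpliced.triangle f (p ≫ e.hom) (e.inv ≫ h)
      (dist_of_iso hT (Iso.refl _) (Iso.refl _) e (by simp) (by simp) (by simp)) t _ ?_
    rw [ShiftedHom.mk₀_comp]
  | splice hd₁ f₁ p₁ h₁ hT₁ c₁ κ₁ hc₁ ih =>
    refine IsSpliced.splice hd f p h hT f₁ (p ≫ f₁) rfl _ t ?_
    have := ih hd₁ f₁ p₁ h₁ hT₁ (h⟦_⟧' ≫ (shiftFunctorAdd' C 1 _ d' hd).inv.app U ≫ t)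
    rw [Chain.snoc_cons] at this
    convert this using 3
    simp [ShiftedHom.comp]

lemma isSpliced_snoc {Z U : C} {d : ℤ} {k : ℕ} {c : Chain Z (k + 2) U} {κ : ShiftedHom Z U d}
    (hc : SplK c κ) {W : C} (t : U⟦d⟧ ⟶ W) : IsSpliced t (c.snoc (κ ≫ t)) := by
  obtain _ | ⟨f, c⟩ := c
  obtain ⟨V, p, h, d, hd, c', κ', hT, rfl, rfl, hc'⟩ := hc.exists_of_cons
  exact isSpliced_snoc_splice hc' hd f p h hT t

end SplK

lemma IsSpliced.exists_splK {W : C} {k : ℕ} {Z U : C} {d : ℤ} {c : Chain Z k U} {l : Z ⟶ W}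
    {t : U⟦d⟧ ⟶ W} (hs : IsSpliced t (c.snoc l)) :
    ∃ κ : ShiftedHom Z U d, l = κ ≫ t ∧ SplK c κ := by
  induction k generalizing U d with
  | zero => nomatch c
  | succ k ih =>
    obtain f | ⟨f, c⟩ := c
    · nomatch hs
    obtain g | ⟨g, c⟩ := c
    · cases hs with
      | triangle f g h hT t α hα =>
        refine ⟨h, hα.symm, ?_⟩
        have := SplK.splice (add_zero 1) f g h hT _ _ (SplK.base (Iso.refl _))
        simpa using this
      | splice hd f p h hT q g hg c t hc => nomatch hc
    · have key : ∀ {d₁ : ℤ} (hd : 1 + d₁ = d) {V : C} (p : _ ⟶ V) (h : V ⟶ U⟦(1 : ℤ)⟧)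
          (_ : Triangle.mk f p h ∈ distTriang C) (q : V ⟶ _) (_ : p ≫ q = g)
          (_ : IsSpliced (d := d₁) (h⟦d₁⟧' ≫ (shiftFunctorAdd' C 1 d₁ d hd).inv.app U ≫ t)
            (Chain.snoc l (Chain.cons q c))), ∃ κ : ShiftedHom Z U d,
              l = κ ≫ t ∧ SplK (Chain.cons f (Chain.cons g c)) κ := by
        rintro d₁ hd V p h hT q rfl hc
        obtain ⟨κ, hκ, hc'⟩ := ih hc
        exact ⟨κ.comp h hd, by simp [hκ, ShiftedHom.comp],
          SplK.splice hd f p h hT _ _ hc'⟩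
      -- Both cases are alike; the distinction exposes the constructor of `snoc l c`, so that
      -- `triangle` is excluded.
      obtain g₂ | ⟨g₂, c⟩ := c
      · cases hs with
        | splice hd f p h hT q g hg c t hc => exact key hd p h hT q hg hc
      · cases hs with
        | splice hd f p h hT q g hg c t hc => exact key hd p h hT q hg hc

/-! ### Rotation and its inverse by the octahedral axiom. -/

namespace SplK

variable [IsTriangulated C]

/-- Splicing triangles over `U`, and a triangle `M ⟶ U ⟶ A ⟶ M⟦1⟧`, give spliced triangles
over `M`. -/
lemma rotate {Z U : C} {d : ℤ} {k : ℕ} {c : Chain Z k U} {κ : ShiftedHom Z U d}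
    (hc : SplK c κ) {M A B : C} {b : M ⟶ U} {e : U ⟶ A} {x : A ⟶ M⟦(1 : ℤ)⟧}
    (hT : Triangle.mk b e x ∈ distTriang C) (ω : B ≅ A⟦d⟧) (ζ : Z ⟶ B)
    (hζ : ζ ≫ ω.hom = κ ≫ e⟦d⟧') {d' : ℤ} (hd : 1 + d = d') :
    SplK ((c.precomp b).snoc ζ) ((-1 : ℤ) ^ (k + 1) • ShiftedHom.comp ω.hom x hd) := by
  induction hc generalizing M A B d' with
  | base e₀ =>
    let i : A ≅ B := (shiftFunctorZero C ℤ).symm.app A ≪≫ ω.symm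
    have hω : ShiftedHom.mk₀ (0 : ℤ) rfl i.inv = ω.hom := by
      simp [i, ShiftedHom.mk₀, shiftFunctorZero']
    have hi : (e₀.inv ≫ e) ≫ i.hom = ζ := by
      rw [← cancel_mono ω.hom, hζ, ← ShiftedHom.comp_mk₀ _ 0 rfl, ShiftedHom.mk₀_comp_mk₀]
      simp [i, ShiftedHom.mk₀, shiftFunctorZero']
    have := SplK.splice hd (b ≫ e₀.hom) (e₀.inv ≫ e) x
      (dist_of_iso hT (Iso.refl _) e₀ (Iso.refl _) (by simp) (by simp) (by simp)) _ _
      (SplK.base i)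
    simpa [hω, hi] using this
  | splice hd₁ f p h hT₁ c κ hc ih =>
    -- The octahedron on M ⟶ U ⟶ X gives A ⟶ M' ⟶ V. Its rotation M' ⟶ V ⟶ A⟦1⟧ feeds the induction
    -- at the price of one sign, and M ⟶ X ⟶ M' becomes the new first triangle.
    obtain ⟨M', v, w, hM'⟩ := distinguished_cocone_triangle (b ≫ f)
    let o := Triangulated.someOctahedron rfl hT hT₁ hM'
    have o₂ : o.m₁ ≫ w = x := o.comm₂
    have o₃ : v ≫ o.m₃ = p := o.comm₃
    have key := ih (dist_rotate_iff.mp o.mem) (ω ≪≫ (shiftFunctorAdd' C 1 _ _ hd₁).app A) ζ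
      (by
        rw [← cancel_mono ((shiftFunctorAdd' C 1 _ _ hd₁).inv.app A)]
        simp [hζ, comp_map_shift]
        simp [ShiftedHom.comp]) hd₁
    have := SplK.splice hd (b ≫ f) v w hM' _ _ key
    rw [← Chain.snoc_precomp, Chain.precomp_precomp, o₃] at this
    have e₁ := comp_map_shift_comp (ω ≪≫ (shiftFunctorAdd' C 1 _ _ hd₁).app A).hom o.m₁ w hd₁ hd
    have e₂ : (ω ≪≫ (shiftFunctorAdd' C 1 _ _ hd₁).app A).hom ≫
      (shiftFunctorAdd' C 1 _ _ hd₁).inv.app A = ω.hom := by simp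
    rw [e₂, o₂] at e₁
    have e₃ (m : ℕ) : ((-1 : ℤ) ^ (m + 1) • ShiftedHom.comp (ω ≪≫ (shiftFunctorAdd' C 1 _ _ hd₁).app A).hom
        (-o.m₁⟦(1 : ℤ)⟧') hd₁).comp w hd = (-1 : ℤ) ^ (m + 1 + 1) • ShiftedHom.comp ω.hom x hd := by
      rw [ShiftedHom.comp_neg, smul_neg, ShiftedHom.neg_comp, pow_succ _ (m + 1), mul_neg_one,
        neg_smul, ← e₁, ShiftedHom.comp, ShiftedHom.comp, Preadditive.zsmul_comp]
      rfl
    rw [e₃] at this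
    exact this

/-- The converse of `SplK.rotate`. -/
lemma exists_unrotate {Z M B : C} {d' : ℤ} {k : ℕ} {c₀ : Chain Z k M} {ζ : Z ⟶ B}
    {κ₀ : ShiftedHom B M d'} (hc : SplK (c₀.snoc ζ) κ₀) :
    ∃ (U A : C) (b : M ⟶ U) (e : U ⟶ A) (x : A ⟶ M⟦(1 : ℤ)⟧) (d : ℤ) (hd : 1 + d = d')
      (c : Chain Z k U) (κ : ShiftedHom Z U d) (ω : B ≅ A⟦d⟧),
      Triangle.mk b e x ∈ distTriang C ∧ c₀ = c.precomp b ∧ SplK c κ ∧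
        ζ ≫ ω.hom = κ ≫ e⟦d⟧' ∧ κ₀ = (-1 : ℤ) ^ (k + 1) • ShiftedHom.comp ω.hom x hd := by
  induction k generalizing M d' with
  | zero => nomatch c₀
  | succ k ih =>
  obtain f | ⟨f, c₁⟩ := c₀
  · obtain ⟨V, p, h, d, hd, c', κ', hT, hc', rfl, hs⟩ := hc.exists_of_cons
    obtain q | ⟨_, c⟩ := c'
    swap
    · nomatch c
    simp only [Chain.precomp_single] at hc'
    obtain rfl := Chain.single.inj hc'
    obtain ⟨e, rfl, rfl, rfl⟩ := hs.exists_of_single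
    refine ⟨_, V, f, p, h, 0, hd, Chain.single (𝟙 _), ShiftedHom.mk₀ 0 rfl (𝟙 _),
      e.symm ≪≫ (shiftFunctorZero C ℤ).symm.app V, hT, by simp, SplK.base (Iso.refl _), ?_, ?_⟩
    · rw [← ShiftedHom.comp_mk₀ _ 0 rfl, ShiftedHom.mk₀_comp_mk₀]
      simp [ShiftedHom.mk₀, shiftFunctorZero']
    · have : (e.symm ≪≫ (shiftFunctorZero C ℤ).symm.app V).hom =
          ShiftedHom.mk₀ (0 : ℤ) rfl e.inv := by
        simp [ShiftedHom.mk₀, shiftFunctorZero']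
      rw [this]
      simp
  · obtain ⟨M', p, h, d₁, hd₁, c', κ', hT, hc', rfl, hs⟩ := hc.exists_of_cons
    obtain ⟨c'', rfl, rfl⟩ := Chain.exists_of_snoc_eq_precomp hc'
    obtain ⟨V, A', b', e', x', d, hd, c, κ, ω, hT', rfl, hcκ, hζ, rfl⟩ := ih hs
    -- The octahedron of `rotate` read backwards: A and U are the fibres of M' ⟶ V and of X ⟶ M' ⟶
    -- V, which gives M ⟶ U ⟶ A. The isomorphism j identifies A' with A⟦1⟧.
    obtain ⟨A, v₂₃, w₂₃, h₂₃⟩ := distinguished_cocone_triangle₁ b'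
    obtain ⟨U, v₁₃, w₁₃, h₁₃⟩ := distinguished_cocone_triangle₁ (p ≫ b')
    have h₂₃' := dist_rotate_iff.mp h₂₃
    obtain ⟨j, hj₁, hj₂⟩ := dist_complete₃ hT' h₂₃' (𝟙 _) (𝟙 _) (by simp)
    rw [Category.id_comp] at hj₁
    rw [CategoryTheory.Functor.map_id, Category.comp_id] at hj₂
    have : IsIso j := isIso_of_dist hT' h₂₃' j hj₁ hj₂.symm
    let o := Triangulated.someOctahedron' rfl hT h₂₃ h₁₃
    have o₁ : o.m₁ ≫ v₁₃ = f := o.comm₁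
    have o₃ : w₁₃ ≫ o.m₃⟦(1 : ℤ)⟧' = w₂₃ := o.comm₃
    refine ⟨U, A, o.m₁, o.m₃, v₂₃ ≫ h, d₁, hd₁, Chain.cons v₁₃ (c.precomp (p ≫ b')),
      κ.comp w₁₃ hd, ω ≪≫ (shiftFunctor C d).mapIso (asIso j) ≪≫
        (shiftFunctorAdd' C 1 d d₁ hd).symm.app A, o.mem, ?_, SplK.splice hd _ _ _ h₁₃ _ _ hcκ,
      ?_, ?_⟩
    · rw [Chain.precomp_cons, o₁, Chain.precomp_precomp]
    · rw [comp_map_shift, o₃, ← hj₁]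
      simp only [Iso.trans_hom, reassoc_of% hζ]
      simp [ShiftedHom.comp]
    · have e₁ := comp_map_shift_comp (ω.hom ≫ j⟦d⟧') v₂₃ h hd hd₁
      rw [map_shift_comp] at e₁
      rw [hj₂, Preadditive.comp_neg, ShiftedHom.comp_neg, smul_neg, ShiftedHom.neg_comp,
        pow_succ _ (_ + 1), mul_neg_one, neg_smul, ShiftedHom.comp, Preadditive.zsmul_comp]
      congr 2
      exact e₁.trans (by simp)

end SplK

end

/-! ### Exact sequences and dimension shifting. -/

section

variable {C : Type u} [Category.{v} C] [Preadditive C] [HasZeroObject C] [HasShift C ℤ]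
  [∀ m : ℤ, (shiftFunctor C m).Additive] [Pretriangulated C]

section

variable {X Y Z : C} {f : X ⟶ Y} {g : Y ⟶ Z} {h : Z ⟶ X⟦(1 : ℤ)⟧}

lemma dist_yoneda₁ (hT : Triangle.mk f g h ∈ distTriang C) {A : C} (a : X ⟶ A)
    (ha : h ≫ a⟦(1 : ℤ)⟧' = 0) : ∃ b : Y ⟶ A, a = f ≫ b := by
  obtain ⟨b, hb⟩ := dist_yoneda₃ (dist_rotate_iff.mp hT) (a⟦(1 : ℤ)⟧') ha
  refine ⟨(shiftFunctor C (1 : ℤ)).preimage (-b), (shiftFunctor C (1 : ℤ)).map_injective ?_⟩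
  rw [hb, Functor.map_comp, Functor.map_preimage, Preadditive.neg_comp, Preadditive.comp_neg]

/-- The n-fold shift of a triangle is distinguished after inserting the sign (-1)ⁿ, which does not
affect exactness. -/
lemma dist_coyoneda₂_shift (hT : Triangle.mk f g h ∈ distTriang C) {A : C} {n : ℤ} (a : A ⟶ Y⟦n⟧)
    (ha : a ≫ g⟦n⟧' = 0) : ∃ b : A ⟶ X⟦n⟧, a = b ≫ f⟦n⟧' := by
  have hT' : Triangle.mk (n.negOnePow • f⟦n⟧') (n.negOnePow • g⟦n⟧')
      (n.negOnePow • h⟦n⟧' ≫ (shiftFunctorComm C 1 n).hom.app X) ∈ distTriang C :=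
    Triangle.shift_distinguished _ hT n
  obtain ⟨b, hb⟩ := dist_coyoneda₂ hT' a (by rw [Linear.comp_units_smul, ha, smul_zero])
  exact ⟨n.negOnePow • b, by rw [hb, Linear.comp_units_smul, Linear.units_smul_comp]⟩

lemma dist_coyoneda₃_shift (hT : Triangle.mk f g h ∈ distTriang C) {A : C} {n m : ℤ}
    (a : A ⟶ Z⟦n⟧) (hm : 1 + n = m) (ha : ShiftedHom.comp a h hm = 0) :
    ∃ b : A ⟶ Y⟦n⟧, a = b ≫ g⟦n⟧' := by
  refine dist_coyoneda₂_shift (dist_rotate_iff.mp hT) a ?_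
  rw [← cancel_mono ((shiftFunctorAdd' C 1 n m hm).inv.app X), zero_comp, Category.assoc]
  exact ha

lemma dist_coyoneda₁_shift (hT : Triangle.mk f g h ∈ distTriang C) {A : C} {n m : ℤ}
    (hm : 1 + n = m) (a : A ⟶ X⟦m⟧) (ha : a ≫ f⟦m⟧' = 0) :
    ∃ b : A ⟶ Z⟦n⟧, a = ShiftedHom.comp b h hm := by
  have e := (shiftFunctorAdd' C 1 n m hm).hom.naturality f
  dsimp at e
  obtain ⟨b, hb⟩ := dist_coyoneda₂_shift (dist_rotate_iff.mp (dist_rotate_iff.mp hT))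
    (a ≫ (shiftFunctorAdd' C 1 n m hm).hom.app X) (by
      rw [Functor.map_neg, Preadditive.comp_neg, Category.assoc, ← e, reassoc_of% ha, zero_comp,
        neg_zero])
  refine ⟨b, ?_⟩
  rw [ShiftedHom.comp, ← reassoc_of% hb]
  simp

end

/-- `Spl t c` says that the chain `c : U ⟶ ⋯ ⟶ Z ⟶ W` is obtained by splicing distinguished
triangles and that its last morphism is the composite of the shifted connecting morphisms
with `t`. -/
inductive Spl {W : C} : {d : ℤ} → {k : ℕ} → {U : C} → (U⟦d⟧ ⟶ W) → Chain W k U → Prop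
  | mk {Z U : C} {d : ℤ} {k : ℕ} {c : Chain Z k U} {κ : ShiftedHom Z U d} (hc : SplK c κ)
      (t : U⟦d⟧ ⟶ W) : Spl t (c.snoc (κ ≫ t))

namespace Spl

lemma base {U Z W : C} (e : U ≅ Z) (t : U⟦(0 : ℤ)⟧ ⟶ W) (α : Z ⟶ W)
    (hα : ShiftedHom.mk₀ (0 : ℤ) rfl e.inv ≫ t = α) :
    Spl t (Chain.cons e.hom (Chain.single α)) := by
  subst hα
  exact Spl.mk (SplK.base e) t

lemma splice {U X V W : C} {d d' : ℤ} (hd : 1 + d = d') {k : ℕ} (f : U ⟶ X) (p : X ⟶ V)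
    (h : V ⟶ U⟦(1 : ℤ)⟧) (hT : Triangle.mk f p h ∈ distTriang C) (c : Chain W k V)
    (t : U⟦d'⟧ ⟶ W)
    (hc : Spl (d := d) (h⟦d⟧' ≫ (shiftFunctorAdd' C 1 d d' hd).inv.app U ≫ t) c) :
    Spl t (Chain.cons f (c.precomp p)) := by
  obtain @⟨_, _, _, k, c₀, κ, hc₀, _⟩ := hc
  have := Spl.mk (SplK.splice hd f p h hT _ _ hc₀) t
  rw [Chain.snoc_cons, Chain.snoc_precomp] at this
  convert this using 4
  simp [ShiftedHom.comp]

lemma isSpliced {W U : C} {d : ℤ} {k : ℕ} {t : U⟦d⟧ ⟶ W} {c : Chain W (k + 3) U}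
    (hc : Spl t c) : IsSpliced t c := by
  cases hc with
  | mk hc t => exact hc.isSpliced_snoc t

lemma comp_eq_zero {W U X Y : C} {d : ℤ} {k : ℕ} {t : U⟦d⟧ ⟶ W} {f : U ⟶ X} {g : X ⟶ Y}
    {c : Chain W k Y} (hc : Spl t (Chain.cons f (Chain.cons g c))) : f ≫ g = 0 := by
  generalize hc' : Chain.cons f (Chain.cons g c) = c' at hc
  obtain @⟨_, _, _, k, c₀, κ, hc₀, _⟩ := hc
  obtain _ | ⟨f₀, c₀⟩ := c₀
  · cases hc'
  · obtain ⟨V, p, h, d₁, hd₁, c₁, κ₁, hT, rfl, rfl, hs⟩ := hc₀.exists_of_cons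
    have hz := dist_zero₁₂ hT
    obtain _ | _ := c₁
    · cases hc'
      rw [reassoc_of% hz, zero_comp]
    · cases hc'
      rw [reassoc_of% hz, zero_comp]

lemma comp_eq_zero_of_single {W U X Y : C} {d : ℤ} {t : U⟦d⟧ ⟶ W} {f : U ⟶ X} {g : X ⟶ Y}
    {α : Y ⟶ W} (hc : Spl t (Chain.cons f (Chain.cons g (Chain.single α)))) : g ≫ α = 0 := by
  generalize hc' : Chain.cons f (Chain.cons g (Chain.single α)) = c' at hc
  obtain @⟨_, _, _, k, c₀, κ, hc₀, _⟩ := hc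
  obtain _ | ⟨f₀, c₀⟩ := c₀
  obtain ⟨V, p, h, d₁, hd₁, c₁, κ₁, hT, rfl, rfl, hs⟩ := hc₀.exists_of_cons
  obtain f₁ | ⟨_, c₁⟩ := c₁
  · cases hc'
    obtain ⟨e, rfl, rfl, rfl⟩ := hs.exists_of_single
    obtain rfl := (add_zero (1 : ℤ)).symm.trans hd₁
    rw [ShiftedHom.mk₀_comp]
    simp [reassoc_of% (dist_zero₂₃ hT)]
  · nomatch c₁

end Spl

/-- All objects of the chain except possibly the first one satisfy `F`. -/
def Inner (F : ObjectProperty C) {Z : C} : {k : ℕ} → {U : C} → Chain Z k U → Prop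
  | _, _, Chain.single _ => F Z
  | _, _, Chain.cons (Y := Y) _ c => F Y ∧ Inner F c

lemma Inner.of_precomp {F : ObjectProperty C} {Z U V : C} {k : ℕ} {p : U ⟶ V} {c : Chain Z k V}
    (h : Inner F (c.precomp p)) : Inner F c := by
  cases c <;> exact h

lemma Inner.map_ι {F : ObjectProperty C} {Z X : F.FullSubcategory} {k : ℕ} (c : Chain Z k X) :
    Inner F (c.map F.ι) := by
  induction c with
  | single f => exact Z.property
  | @cons k X Y f c ih => exact ⟨Y.property, ih⟩

namespace SplK

lemma degree_nonneg {U Z : C} {d : ℤ} {k : ℕ} {c : Chain Z k U} {κ : ShiftedHom Z U d}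
    (hc : SplK c κ) : 0 ≤ d := by
  induction hc with
  | base e => rfl
  | splice hd f p h hT c κ hc ih => omega

/-- κ is invertible in degree zero. This replaces the vanishing of morphisms in the last step of the
cone construction. -/
lemma exists_comp_eq_of_degree_zero {U Z Y : C} {d : ℤ} {k : ℕ} {c : Chain Z k U}
    {κ : ShiftedHom Z U d} (hc : SplK c κ) (hd : d = 0) (a : Z ⟶ Y⟦d⟧) :
    ∃ s : U ⟶ Y, κ ≫ s⟦d⟧' = a := by
  cases hc with
  | base e =>
    refine ⟨e.hom ≫ a ≫ (shiftFunctorZero' C (0 : ℤ) rfl).hom.app Y, ?_⟩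
    rw [← ShiftedHom.comp_mk₀ _ 0 rfl, ShiftedHom.mk₀_comp_mk₀]
    simp [ShiftedHom.mk₀]
  | splice hd₁ f p h hT c κ hc =>
    have := hc.degree_nonneg
    omega

/-- Morphisms of small positive degree to an object of `F` are detected by `κ`. -/
lemma eq_zero_of_comp_eq_zero {F : ObjectProperty C} {D : ℤ}
    (hF : ∀ X Y : C, F X → F Y → ∀ j : ℤ, 0 < j → j < D → ∀ f : X ⟶ Y⟦j⟧, f = 0)
    {U Z : C} {d : ℤ} {k : ℕ} {c : Chain Z k U} {κ : ShiftedHom Z U d} (hc : SplK c κ)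
    (hi : Inner F c) {Y : C} (hY : F Y) {j m : ℤ} (hj : 0 < j) (hjd : j + d ≤ D)
    (o : ShiftedHom U Y j) (hm : j + d = m) (ho : κ.comp o hm = 0) : o = 0 := by
  induction hc generalizing j m with
  | base e =>
    obtain rfl : m = j := by omega
    rw [ShiftedHom.mk₀_comp] at ho
    rwa [← cancel_epi e.inv, comp_zero]
  | @splice U X V d d' hd k f p h hT c κ hc ih =>
    have hd₀ := hc.degree_nonneg
    -- By induction h ≫ o⟦1⟧ vanishes, so o factors through f, and the other factor lies in Hom(X,
    -- Y⟦j⟧) = 0. The bound on j + d is preserved, as j rises by one when d drops by one.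
    have h₁ := ih hi.2.of_precomp (j := j + 1) (m := m) (by omega) (by omega)
      (ShiftedHom.comp h o rfl) (by omega) (by
        rw [← ShiftedHom.comp_assoc κ h o hd rfl (by omega)]
        exact ho)
    obtain ⟨b, rfl⟩ := dist_yoneda₁ hT o (by
      rw [← cancel_mono ((shiftFunctorAdd' C j 1 _ rfl).inv.app Y), Category.assoc, zero_comp]
      exact h₁)
    rw [hF _ _ hi.1 hY j hj (by omega) b, comp_zero]

end SplK

end

/-! ### Construction of cones. -/

section

variable {C : Type u} [Category.{v} C] [Preadditive C] [HasZeroObject C] [HasShift C ℤ]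
  [∀ m : ℤ, (shiftFunctor C m).Additive] [Pretriangulated C] [IsTriangulated C]

/-- One step of the construction of cones: given spliced triangles over `M` and `P` and an extension
`N` of `M` by `P`, the horseshoe lemma gives an extension of the first cosyzygies to which the
auxiliary morphisms `y` and `l` extend. -/
lemma exists_cone_step {F : ObjectProperty C} {D : ℤ}
    (hF : ∀ X Y : C, F X → F Y → ∀ j : ℤ, 0 < j → j < D → ∀ f : X ⟶ Y⟦j⟧, f = 0)
    {P Q P' M X M' N B Q' Z : C} {f' : P ⟶ Q} {p' : Q ⟶ P'}
    {h' : P' ⟶ P⟦(1 : ℤ)⟧} (hP : Triangle.mk f' p' h' ∈ distTriang C) {f : M ⟶ X} {p : X ⟶ M'}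
    {h : M' ⟶ M⟦(1 : ℤ)⟧} (hM : Triangle.mk f p h ∈ distTriang C) {i : P ⟶ N} {π : N ⟶ M}
    {δ : M ⟶ P⟦(1 : ℤ)⟧} (hN : Triangle.mk i π δ ∈ distTriang C) (y : N ⟶ Q) (hy : i ≫ y = f')
    (S : SumData X Q B) (hQ' : F Q') {d₁ d : ℤ} (hd : 1 + d₁ = d) (hdD : d ≤ D)
    {k : ℕ} {c : Chain Z k M'} {κ : ShiftedHom Z M' d₁} (hc : SplK c κ) (hi : Inner F c)
    (hZ : F Z) (l : Z ⟶ N⟦d⟧) (hly : l ≫ y⟦d⟧' = 0) (s : ℕ)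
    (hl : l ≫ π⟦d⟧' = (-1 : ℤ) ^ s • κ.comp h hd) (f₁' : P' ⟶ Q') :
    ∃ (N' : C) (q : B ⟶ N') (k : N' ⟶ N⟦(1 : ℤ)⟧) (i' : P' ⟶ N') (π' : N' ⟶ M')
      (δ' : M' ⟶ P'⟦(1 : ℤ)⟧) (y' : N' ⟶ Q') (l' : ShiftedHom Z N' d₁),
      Triangle.mk (-(π ≫ f ≫ S.inl) + y ≫ S.inr) q k ∈ distTriang C ∧
      Triangle.mk i' π' δ' ∈ distTriang C ∧ i' ≫ y' = f₁' ∧ S.inr ≫ q = p' ≫ i' ∧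
      q ≫ π' = S.fst ≫ p ∧ i' ≫ k = h' ≫ i⟦(1 : ℤ)⟧' ∧ l'.comp k hd = l ∧
      l' ≫ y'⟦d₁⟧' = 0 ∧ l' ≫ π'⟦d₁⟧' = (-1 : ℤ) ^ (s + 1) • κ := by
  -- The horseshoe is applied to -f, since the cone has -α on its diagonal; this makes the sign of κ
  -- alternate.
  have hM' : Triangle.mk (-f) p (-h) ∈ distTriang C :=
    dist_of_iso hM (-Iso.refl _) (Iso.refl _) (Iso.refl _) (by simp) (by simp) (by simp)
  obtain ⟨N', q, k, i', π', δ', hT, hT', e₁, e₂, e₃, e₄⟩ := exists_horseshoe hP hM' hN y hy S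
  have hT₂ : Triangle.mk (-(π ≫ f ≫ S.inl) + y ≫ S.inr) q k ∈ distTriang C := by
    simpa using hT
  have hκ : (κ.comp h hd) ≫ f⟦d⟧' = 0 := by
    rw [comp_map_shift, dist_zero₃₁ hM, ShiftedHom.comp_zero]
  -- Both components of l in B⟦d⟧ vanish, so l lifts through k.
  obtain ⟨l₀, hl₀⟩ := dist_coyoneda₁_shift hT₂ hd l (by
    rw [Functor.map_add, Functor.map_neg, Functor.map_comp, Functor.map_comp, Functor.map_comp,
      Preadditive.comp_add, Preadditive.comp_neg, reassoc_of% hl, reassoc_of% hly]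
    simp [reassoc_of% hκ])
  -- The lift projects to the required multiple of κ only up to a morphism killed by h, hence up to
  -- some σ through X⟦d₁⟧. Subtracting σ along X ⟶ B ⟶ N' corrects this without changing l.
  have hl₁ : ShiftedHom.comp (l₀ ≫ π'⟦d₁⟧' + (-1 : ℤ) ^ s • κ) h hd = 0 := by
    have : (-1 : ℤ) ^ s • κ.comp h hd = -(ShiftedHom.comp (l₀ ≫ π'⟦d₁⟧') h hd) := by
      rw [← hl, hl₀, comp_map_shift, e₄, map_shift_comp, Preadditive.comp_neg, ShiftedHom.comp_neg]
    rw [ShiftedHom.add_comp, ShiftedHom.comp, ShiftedHom.comp, Preadditive.zsmul_comp]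
    exact (congrArg₂ (· + ·) rfl this).trans (add_neg_cancel _)
  obtain ⟨σ, hσ⟩ := dist_coyoneda₃_shift hM _ hd hl₁
  obtain ⟨l₁, hl₁k, hl₁π⟩ : ∃ l₁ : ShiftedHom Z N' d₁, l₁.comp k hd = l ∧
      l₁ ≫ π'⟦d₁⟧' = (-1 : ℤ) ^ (s + 1) • κ := by
    refine ⟨l₀ - σ ≫ (S.inl ≫ q)⟦d₁⟧', ?_, ?_⟩
    · rw [sub_eq_add_neg, ShiftedHom.add_comp, ShiftedHom.neg_comp, map_shift_comp, Category.assoc,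
        dist_zero₂₃ hT, comp_zero, ShiftedHom.comp_zero, neg_zero, add_zero, hl₀]
    · rw [Preadditive.sub_comp, Category.assoc, ← Functor.map_comp, Category.assoc, e₂,
        S.inl_fst_assoc, ← hσ, pow_succ, mul_neg_one, neg_smul]
      abel
  -- The obstruction δ' ≫ f₁'⟦1⟧ is detected by κ, and κ · δ' = ± l₁ ≫ π' · δ' = 0.
  obtain ⟨y₀, hy₀⟩ := dist_yoneda₁ hT' f₁' (by
    refine hc.eq_zero_of_comp_eq_zero hF hi hQ' one_pos (by omega) _ hd ?_
    rw [← comp_map_shift]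
    have : (-1 : ℤ) ^ (s + 1) • κ.comp δ' hd = 0 := by
      have h₀ : (ShiftedHom.comp (l₁ ≫ π'⟦d₁⟧') δ' hd) = 0 := by
        rw [map_shift_comp, dist_zero₂₃ hT', ShiftedHom.comp_zero]
      rw [hl₁π, ShiftedHom.comp, Preadditive.zsmul_comp] at h₀
      exact h₀
    have h₁ : κ.comp δ' hd = 0 := by
      obtain h | h := neg_one_pow_eq_or ℤ (s + 1)
      · rwa [h, one_smul] at this
      · rwa [h, neg_smul, one_smul, neg_eq_zero] at this
    rw [h₁, zero_comp])
  have hd₁ := hc.degree_nonneg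
  -- For d₁ > 0 the composite of l₁ with y₀ vanishes by rigidity. For d₁ = 0 it is removed by
  -- changing y₀ along π', which leaves i' ≫ y₀ unchanged.
  obtain hd₁ | hd₁ := hd₁.lt_or_eq
  · exact ⟨N', q, k, i', π', δ', y₀, l₁, hT₂, hT', hy₀.symm, e₁, e₂, e₃, hl₁k,
      hF _ _ hZ hQ' d₁ hd₁ (by omega) _, hl₁π⟩
  · obtain ⟨t, ht⟩ := hc.exists_comp_eq_of_degree_zero hd₁.symm
      ((-1 : ℤ) ^ (s + 1) • (l₁ ≫ y₀⟦d₁⟧'))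
    refine ⟨N', q, k, i', π', δ', y₀ - π' ≫ t, l₁, hT₂, hT', ?_, e₁, e₂, e₃, hl₁k, ?_, hl₁π⟩
    · rw [Preadditive.comp_sub, ← hy₀, ← Category.assoc, dist_zero₁₂ hT', zero_comp, sub_zero]
    · rw [Functor.map_sub, Functor.map_comp, Preadditive.comp_sub, reassoc_of% hl₁π,
        Preadditive.zsmul_comp, ht, smul_smul, ← mul_pow]
      simp

end

namespace Chain

section

variable {A : Type u} [Category.{v} A]

/-- Extend a morphism of chains at its beginning, when the target is of the form `snoc v c'`. -/
def Hom.consSnoc {Z Z' W : A} {b : Z ⟶ W} {v : Z' ⟶ W} {n : ℕ} {X₀ X Y₀ : A} {g : X₀ ⟶ X}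
    {c : Chain Z n X} : {c' : Chain Z' n Y₀} → (m₀ : X₀ ⟶ Y₀) → (m : X ⟶ c'.second) →
      (g ≫ m = m₀ ≫ c'.head) → Hom b c (c'.tailSnoc v) m → Hom b (Chain.cons g c) (snoc v c') m₀
  | Chain.single _, _, m, w, φ => Hom.cons m w φ
  | Chain.cons _ _, _, m, w, φ => Hom.cons m w φ

lemma Hom.cone_consSnoc [Preadditive A] [HasBinaryBiproducts A] {Z Z' W : A} {b : Z ⟶ W}
    {v : Z' ⟶ W} {n : ℕ} {X₀ X Y₀ : A} {g : X₀ ⟶ X} {c : Chain Z n X} {c' : Chain Z' n Y₀}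
    (m₀ : X₀ ⟶ Y₀) (m : X ⟶ c'.second) (w : g ≫ m = m₀ ≫ c'.head) (φ : Hom b c (c'.tailSnoc v) m)
    {W' : A} (l : Z ⟶ W') (r : W ⟶ W') :
    (Hom.consSnoc m₀ m w φ).cone l r =
      Chain.cons (biprod.desc (biprod.lift (-c.head) m) (biprod.lift 0 c'.head)) (φ.cone l r) := by
  cases c' <;> rfl

end

end Chain

section

variable {C : Type u} [Category.{v} C] [Preadditive C] [HasZeroObject C] [HasShift C ℤ]
  [∀ m : ℤ, (shiftFunctor C m).Additive] [Pretriangulated C] [IsTriangulated C]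

/-- The horseshoe forces three entries of the differential. The fourth, X ⟶ Q₂, is the restriction
of q ≫ y' and serves as the next component of φ. -/
lemma comp_cone_eq {F : ObjectProperty C} [HasBinaryBiproducts F.FullSubcategory]
    {X Q X₂ Q₂ : F.FullSubcategory} {g : X ⟶ X₂} {g' : Q ⟶ Q₂} {m : X ⟶ Q₂} {P' M' N' : C}
    {q : F.ι.obj (X ⊞ Q) ⟶ N'} {π' : N' ⟶ M'} {y' : N' ⟶ F.ι.obj Q₂} {i' : P' ⟶ N'}
    {p : F.ι.obj X ⟶ M'} {p' : F.ι.obj Q ⟶ P'}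
    {f₁ : M' ⟶ F.ι.obj X₂} {f₁' : P' ⟶ F.ι.obj Q₂}
    (hq : q ≫ π' = F.ι.map biprod.fst ≫ p) (hq' : F.ι.map biprod.inr ≫ q = p' ≫ i')
    (hy : i' ≫ y' = f₁') (hg : p ≫ f₁ = F.ι.map g) (hg' : p' ≫ f₁' = F.ι.map g')
    (hm : F.ι.map m = F.ι.map biprod.inl ≫ q ≫ y') :
    q ≫ (-(π' ≫ f₁ ≫ F.ι.map biprod.inl) + y' ≫ F.ι.map biprod.inr) =
      F.ι.map (biprod.desc (biprod.lift (-g) m) (biprod.lift 0 g')) := by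
  have e₁ : biprod.desc (biprod.lift (-g) m) (biprod.lift 0 g') =
      -(biprod.fst ≫ g ≫ biprod.inl) + (biprod.fst ≫ m + biprod.snd ≫ g') ≫ biprod.inr := by
    apply biprod.hom_ext' <;> apply biprod.hom_ext <;> simp
  have e₂ : q ≫ y' = F.ι.map biprod.fst ≫ F.ι.map m + F.ι.map biprod.snd ≫ F.ι.map g' := by
    let S := (SumData.ofBiprod X Q).map F.ι
    refine S.hom_ext_src ?_ ?_
    · have h₁ : S.inl ≫ F.ι.map biprod.fst ≫ F.ι.map m = F.ι.map m := S.inl_fst_assoc _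
      have h₂ : S.inl ≫ F.ι.map biprod.snd ≫ F.ι.map g' = 0 := by
        rw [← zero_comp]; exact S.inl_snd_assoc _
      rw [Preadditive.comp_add, h₁, h₂, add_zero]
      exact hm.symm
    · have h₁ : S.inr ≫ F.ι.map biprod.fst ≫ F.ι.map m = 0 := by
        rw [← zero_comp]; exact S.inr_fst_assoc _
      have h₂ : S.inr ≫ F.ι.map biprod.snd ≫ F.ι.map g' = F.ι.map g' := S.inr_snd_assoc _
      rw [Preadditive.comp_add, h₁, h₂, zero_add]
      exact ((reassoc_of% hq') y').trans (by rw [hy, hg'])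
  rw [e₁, Preadditive.comp_add, Preadditive.comp_neg, reassoc_of% hq, reassoc_of% hg,
    reassoc_of% e₂]
  simp only [Functor.map_add, Functor.map_neg, Functor.map_comp]

end

section

variable {C : Type u} [Category.{v} C] [Preadditive C] [HasZeroObject C] [HasShift C ℤ]
  [∀ m : ℤ, (shiftFunctor C m).Additive] [Pretriangulated C] [IsTriangulated C]

/-- The entry X ⟶ Q₃ of the product of the two matrices is -(g ≫ m') + m ≫ g₂'. -/
lemma comp_eq_of_cone_comp_eq_zero {A : Type u'} [Category.{v'} A] [Preadditive A]
    [HasBinaryBiproducts A] {X X₂ X₃ Q Q₂ Q₃ : A} {g : X ⟶ X₂} {g₂ : X₂ ⟶ X₃} {g' : Q ⟶ Q₂}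
    {g₂' : Q₂ ⟶ Q₃} {m : X ⟶ Q₂} {m' : X₂ ⟶ Q₃}
    (h : biprod.desc (biprod.lift (-g) m) (biprod.lift 0 g') ≫
      biprod.desc (biprod.lift (-g₂) m') (biprod.lift 0 g₂') = 0) : g ≫ m' = m ≫ g₂' := by
  have h₁ := biprod.inl ≫= (h =≫ biprod.snd)
  simp only [biprod.inl_desc_assoc, biprod.lift_eq, biprod.inr_desc_assoc, Category.assoc,
    comp_zero, zero_comp, Preadditive.add_comp, Preadditive.neg_comp, biprod.inl_snd,
    biprod.inr_snd, Category.comp_id, zero_add, neg_zero] at h₁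
  exact neg_add_eq_zero.mp h₁

/-- The identification of `N'` with a biproduct at the end of the construction of cones. -/
lemma exists_iso_biproduct {P' Z' N' M' Z B : C} {i' : P' ⟶ N'} {π' : N' ⟶ M'}
    {δ' : M' ⟶ P'⟦(1 : ℤ)⟧} (hT : Triangle.mk i' π' δ' ∈ distTriang C) (e : M' ≅ Z) (e' : P' ≅ Z')
    (S : SumData Z Z' B) (y' : N' ⟶ Z') (hy : i' ≫ y' = e'.hom) (L : Z ⟶ N')
    (hL : L ≫ y' = 0) (hLπ : L ≫ π' = -e.inv) :
    ∃ w : N' ≅ B, w.hom = -(π' ≫ e.hom ≫ S.inl) + y' ≫ S.inr ∧ S.inl ≫ w.inv = L ∧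
      S.inr ≫ w.inv = e'.inv ≫ i' := by
  let a : N' ⟶ B := -(π' ≫ e.hom ≫ S.inl) + y' ≫ S.inr
  let b : B ⟶ N' := S.fst ≫ L + S.snd ≫ e'.inv ≫ i'
  have hz := dist_zero₁₂ hT
  have hba : b ≫ a = 𝟙 B := by
    refine S.hom_ext_src ?_ ?_ <;>
    simp [a, b, reassoc_of% hLπ, reassoc_of% hL, reassoc_of% hz, reassoc_of% hy]
  -- A morphism killed by a is killed by π', so it lifts to P', where the component e' detects it.
  have ha : Mono a := by
    refine Preadditive.mono_of_cancel_zero _ fun {G} t ht => ?_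
    have h₁ := ht =≫ S.fst
    simp only [a, Preadditive.add_comp, Preadditive.comp_add, Preadditive.neg_comp, Category.assoc,
      Preadditive.comp_neg, S.inl_fst, S.inr_fst, Category.comp_id, comp_zero, add_zero,
      zero_comp, neg_eq_zero] at h₁
    have h₁' : t ≫ π' = 0 := by
      rw [← cancel_mono e.hom, Category.assoc, h₁, zero_comp]
    obtain ⟨u, rfl⟩ := dist_coyoneda₂ hT t h₁'
    have h₂ := ht =≫ S.snd
    simp only [a, Preadditive.add_comp, Preadditive.comp_add, Preadditive.neg_comp, Category.assoc,
      Preadditive.comp_neg, S.inl_snd, S.inr_snd, Category.comp_id, comp_zero, zero_add,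
      zero_comp, neg_zero, hy] at h₂
    have : u = 0 := by rw [← cancel_mono e'.hom, h₂, zero_comp]
    rw [this, zero_comp]
  exact ⟨⟨a, b, by rw [← cancel_mono a, Category.assoc, hba, Category.comp_id, Category.id_comp],
    hba⟩, rfl, by simp [b], by simp [b]⟩

/-- The construction of cones of morphisms between spliced sequences. -/
lemma exists_hom_cone_spl {F : ObjectProperty C} [HasBinaryBiproducts F.FullSubcategory] {D : ℤ}
    (hF : ∀ X Y : C, F X → F Y → ∀ j : ℤ, 0 < j → j < D → ∀ f : X ⟶ Y⟦j⟧, f = 0)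
    {k : ℕ} {X Q Z Z' W W' : F.FullSubcategory} (c : Chain Z k X) (c' : Chain Z' k Q)
    {M P N : C} (f : M ⟶ F.ι.obj X) (f' : P ⟶ F.ι.obj Q) {d : ℤ} (hdD : d ≤ D)
    {κ : ShiftedHom (F.ι.obj Z) M d} {κ' : ShiftedHom (F.ι.obj Z') P d}
    (hc : SplK (Chain.cons f (c.map F.ι)) κ) (hc' : SplK (Chain.cons f' (c'.map F.ι)) κ')
    {i : P ⟶ N} {π : N ⟶ M} {δ : M ⟶ P⟦(1 : ℤ)⟧} (hN : Triangle.mk i π δ ∈ distTriang C)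
    (y : N ⟶ F.ι.obj Q) (hy : i ≫ y = f') (b : Z ⟶ W') (q : W ⟶ W') (l : Z ⟶ W) (r : W' ⟶ W)
    (hrq : r ≫ q = 𝟙 W') (hlq : l ≫ q = b) (τ : N⟦d⟧ ⟶ F.ι.obj W) (v : Z' ⟶ W')
    (l' : F.ι.obj Z ⟶ N⟦d⟧) (hl'τ : l' ≫ τ = F.ι.map l) (hl'y : l' ≫ y⟦d⟧' = 0)
    (hl'π : l' ≫ π⟦d⟧' = (-1 : ℤ) ^ (k + 1) • κ) (hκ' : κ' ≫ i⟦d⟧' ≫ τ = F.ι.map (v ≫ r)) :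
    ∃ (m : X ⟶ c'.second) (φ : Chain.Hom b c (c'.tailSnoc v) m),
      Spl τ (Chain.cons (-(π ≫ f ≫ F.ι.map biprod.inl) + y ≫ F.ι.map biprod.inr)
        (Chain.map F.ι (Chain.cons
          (biprod.desc (biprod.lift (-c.head) m) (biprod.lift 0 c'.head)) (φ.cone l r)))) := by
  -- In the application W = Σ(X₂ ⊞ Y₁) and W' = ΣY₁, with r and q the inclusion and projection, and
  -- l is the component of the last differential on ΣX₁. The morphism l' carries the invariant: zero
  -- against y, and ±κ against π with a sign depending on the remaining length.
  induction k generalizing X Q M P N d with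
  | zero => nomatch c
  | succ k ih =>
    obtain ⟨M', p, h, d₁, hd, c₁, κ₁, hM, hc₁, rfl, hκ₁⟩ := hc.exists_of_cons
    obtain ⟨P', p', h', d₁', hd', c₁', κ₁', hP, hc₁', rfl, hκ₁'⟩ := hc'.exists_of_cons
    obtain rfl : d₁' = d₁ := by omega
    let S := (SumData.ofBiprod X Q).map F.ι
    have hi : Inner F c₁ := Inner.of_precomp (p := p) (hc₁ ▸ Inner.map_ι c)
    obtain g | @⟨_, _, X₂, g, c₂⟩ := c
    · obtain g' | ⟨_, c₂'⟩ := c'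
      swap
      · nomatch c₂'
      obtain f₁ | ⟨_, c₁⟩ := c₁
      swap
      · nomatch c₁
      obtain f₁' | ⟨_, c₁'⟩ := c₁'
      swap
      · nomatch c₁'
      obtain ⟨e, rfl, rfl, rfl⟩ := hκ₁.exists_of_single
      obtain ⟨e', hd₀, rfl, rfl⟩ := hκ₁'.exists_of_single
      have hg : F.ι.map g = p ≫ e.hom := Chain.single.inj hc₁
      have hg' : F.ι.map g' = p' ≫ e'.hom := Chain.single.inj hc₁'
      obtain ⟨N', qq, kk, i', π', δ', y', l₁, hT, hT', e₁, e₂, e₃, e₄, e₅, e₆, e₇⟩ :=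
        exists_cone_step hF hP hM hN y hy S Z'.property hd hdD hκ₁ hi Z.property l' hl'y 2
          hl'π e'.hom
      -- In degree zero l₁ is an ordinary morphism. Up to sign it splits N' ⟶ M' ≅ Z, and it is
      -- killed by y'.
      obtain ⟨L, rfl⟩ : ∃ L : F.ι.obj Z ⟶ N', l₁ = ShiftedHom.mk₀ 0 rfl L :=
        ⟨(ShiftedHom.homEquiv (0 : ℤ) rfl).symm l₁, ((ShiftedHom.homEquiv (0 : ℤ) rfl).right_inv l₁).symm⟩
      have hL : L ≫ y' = 0 := by
        apply (ShiftedHom.homEquiv (0 : ℤ) rfl).injective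
        simpa [ShiftedHom.homEquiv, mk₀_comp_map_shift] using e₆
      have hLπ : L ≫ π' = -e.inv := by
        apply (ShiftedHom.homEquiv (0 : ℤ) rfl).injective
        refine ((mk₀_comp_map_shift _ _).symm.trans e₇).trans ?_
        simp [ShiftedHom.homEquiv, ShiftedHom.mk₀]
      obtain ⟨w, hw, hw₁, hw₂⟩ := exists_iso_biproduct hT' e e'
        ((SumData.ofBiprod Z Z').map F.ι) y' e₁ L hL hLπ
      replace hw : w.hom = -(π' ≫ e.hom ≫ F.ι.map biprod.inl) + y' ≫ F.ι.map biprod.inr := hw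
      obtain ⟨m, hm⟩ := F.ι.map_surjective (S.inl ≫ qq ≫ y')
      have hq := comp_cone_eq e₃ e₂ e₁ hg.symm hg'.symm hm
      have hα : ShiftedHom.mk₀ (0 : ℤ) rfl w.inv ≫
          (kk⟦(0 : ℤ)⟧' ≫ (shiftFunctorAdd' C 1 0 d hd).inv.app N ≫ τ) =
            F.ι.map (biprod.desc l (v ≫ r)) := by
        refine Eq.trans (b := ShiftedHom.comp (ShiftedHom.mk₀ (0 : ℤ) rfl w.inv) kk hd ≫ τ) ?_ ?_
        · simp [ShiftedHom.comp]
        rw [mk₀_comp_of_eq]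
        refine ((SumData.ofBiprod Z Z').map F.ι).hom_ext_src ?_ ?_
        · rw [reassoc_of% hw₁, ← mk₀_comp_of_eq _ _ hd, e₅, hl'τ]
          exact ((F.ι.map_comp _ _).symm.trans (congrArg F.ι.map (biprod.inl_desc _ _))).symm
        · rw [← Category.assoc, comp_map_shift, ← e₄, mk₀_comp_of_eq, Category.assoc] at hκ'
          rw [reassoc_of% hw₂, hκ']
          exact ((F.ι.map_comp _ _).symm.trans (congrArg F.ι.map (biprod.inr_desc _ _))).symm
      have key := Spl.splice hd _ qq kk hT _ τ (Spl.base w _ _ hα)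
      rw [Chain.precomp_cons, hw] at key
      rw [hq] at key
      -- The last square comes from the final two differentials, followed by the projection q.
      have sq : g ≫ b = m ≫ v := by
        have h₀ : biprod.desc (biprod.lift (-g) m) (biprod.lift 0 g') ≫ biprod.desc l (v ≫ r) = 0 :=
          F.ι.map_injective ((F.ι.map_comp _ _).trans <| key.comp_eq_zero_of_single.trans (F.ι.map_zero _ _).symm)
        have h₁ := biprod.inl ≫= (h₀ =≫ q)
        simp only [biprod.inl_desc_assoc, biprod.lift_eq, biprod.inr_desc_assoc, Category.assoc, comp_zero,
          zero_comp,
          Preadditive.add_comp, Preadditive.neg_comp, hlq, hrq, Category.comp_id] at h₁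
        exact (neg_add_eq_zero.mp h₁)
      exact ⟨m, Chain.Hom.single sq, key⟩
    · obtain g' | @⟨_, _, Q₂, g', c₂'⟩ := c'
      · nomatch c₂
      obtain f₁ | @⟨_, _, _, f₁, c₁⟩ := c₁
      · nomatch c₂
      obtain f₁' | @⟨_, _, _, f₁', c₁'⟩ := c₁'
      · nomatch c₂
      obtain ⟨rfl, hg, hc₁⟩ := Chain.cons.inj hc₁
      obtain ⟨rfl, hg', hc₁'⟩ := Chain.cons.inj hc₁'
      obtain rfl := eq_of_heq hc₁
      obtain rfl := eq_of_heq hc₁'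
      replace hg := eq_of_heq hg
      replace hg' := eq_of_heq hg'
      obtain ⟨N', qq, kk, i', π', δ', y', l₁, hT, hT', e₁, e₂, e₃, e₄, e₅, e₆, e₇⟩ :=
        exists_cone_step hF hP hM hN y hy S Q₂.property hd hdD hκ₁ hi Z.property l' hl'y _
          hl'π f₁'
      obtain ⟨m', φ', hφ'⟩ := ih c₂ c₂' f₁ f₁' (by omega) hκ₁ hκ₁' hT' y' e₁
        (kk⟦_⟧' ≫ (shiftFunctorAdd' C 1 _ d hd).inv.app N ≫ τ) l₁ (by
            rw [← hl'τ, ← e₅]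
            simp [ShiftedHom.comp]) e₆ (by rw [e₇, pow_succ _ (k + 1 + 1), pow_succ _ (k + 1)]; simp) (by
            rw [← hκ', ← Category.assoc (ShiftedHom.comp _ _ _) _ τ, comp_map_shift, ← e₄, ← map_shift_comp]
            simp [ShiftedHom.comp])
      obtain ⟨m, hm⟩ := F.ι.map_surjective (S.inl ≫ qq ≫ y')
      have hq := comp_cone_eq e₃ e₂ e₁ hg.symm hg'.symm hm
      have key := Spl.splice hd _ qq kk hT _ τ hφ'
      rw [Chain.precomp_cons, hq] at key
      have sq : g ≫ m' = m ≫ c₂'.head := by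
        have hc₀ : qq ≫ (-(π' ≫ f₁ ≫ F.ι.map biprod.inl) + y' ≫ F.ι.map biprod.inr) ≫ F.ι.map
            (biprod.desc (biprod.lift (-c₂.head) m') (biprod.lift 0 c₂'.head)) = 0 :=
          (qq ≫= hφ'.comp_eq_zero).trans comp_zero
        rw [reassoc_of% hq] at hc₀
        have h₀ : biprod.desc (biprod.lift (-g) m) (biprod.lift 0 g') ≫
            biprod.desc (biprod.lift (-c₂.head) m') (biprod.lift 0 c₂'.head) = 0 :=
          F.ι.map_injective ((F.ι.map_comp _ _).trans (hc₀.trans (F.ι.map_zero _ _).symm))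
        exact comp_eq_of_cone_comp_eq_zero h₀
      refine ⟨m, Chain.Hom.consSnoc m m' sq φ', ?_⟩
      have e := Chain.Hom.cone_consSnoc m m' sq φ' l r
      exact (congrArg (fun t => Spl τ (Chain.cons
        (-(π ≫ f ≫ F.ι.map biprod.inl) + y ≫ F.ι.map biprod.inr) (Chain.map F.ι
          (Chain.cons (biprod.desc (biprod.lift (-g) m) (biprod.lift 0 g')) t)))) e).mpr key

end

/-! ### Rotation in the form of axiom (F2). -/

namespace SplK

section

variable {C : Type u} [Category.{v} C] [Preadditive C] [HasZeroObject C] [HasShift C ℤ]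
  [∀ m : ℤ, (shiftFunctor C m).Additive] [Pretriangulated C] [IsTriangulated C]

lemma comp_shiftFunctorAdd'_hom {U X : C} {d d' : ℤ} (hd : 1 + d = d') (f : U ⟶ X) :
    ShiftedHom.comp ((shiftFunctorAdd' C 1 d d' hd).hom.app U) (f⟦(1 : ℤ)⟧') hd = f⟦d'⟧' := by
  have := (shiftFunctorAdd' C 1 d d' hd).hom.naturality f
  dsimp at this
  rw [ShiftedHom.comp, ← reassoc_of% this]
  simp

/-- The left rotation of a spliced sequence. -/
lemma left_rotate {U X Z : C} {d : ℤ} {k : ℕ} {f : U ⟶ X} {c : Chain Z k X} {κ : Z ⟶ U⟦d⟧}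
    (hc : SplK (Chain.cons f c) κ) :
    SplK (c.snoc κ) ((-1 : ℤ) ^ k • f⟦d⟧' : ShiftedHom (U⟦d⟧) X d) := by
  obtain ⟨V, p, h, d₁, hd, c', κ', hT, rfl, rfl, hc'⟩ := hc.exists_of_cons
  -- The triangles over V are rotated along X ⟶ V ⟶ U⟦1⟧, whose connecting morphism -f⟦1⟧
  -- contributes the remaining sign.
  have := hc'.rotate (dist_rotate_iff.mp hT) ((shiftFunctorAdd' C 1 d₁ d hd).app U)
    (κ'.comp h hd) (by simp [ShiftedHom.comp]) hd
  rw [ShiftedHom.comp_neg, smul_neg, pow_succ, mul_neg_one, neg_smul, neg_neg, Iso.app_hom,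
    comp_shiftFunctorAdd'_hom] at this
  exact this

/-- A sequence whose left rotation is spliced is spliced. -/
lemma of_left_rotate {U X Z : C} {d' : ℤ} {k : ℕ} {f : U ⟶ X} {c : Chain Z k X} {ζ : Z ⟶ U⟦d'⟧}
    (hc : SplK (c.snoc ζ) ((-1 : ℤ) ^ k • f⟦d'⟧' : ShiftedHom (U⟦d'⟧) X d')) :
    SplK (Chain.cons f c) ζ := by
  obtain ⟨V, A, b, e, x, d, hd, c, κ, ω, hT, rfl, hcκ, hζ, hκ⟩ := hc.exists_unrotate
  -- The given isomorphism exists only after shifting by d; full faithfulness of the shift descends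
  -- it.
  let θ : U⟦(1 : ℤ)⟧ ≅ A := (shiftFunctor C d).preimageIso
    ((shiftFunctorAdd' C 1 d d' hd).symm.app U ≪≫ ω)
  have hθ : θ.hom⟦d⟧' = (shiftFunctorAdd' C 1 d d' hd).inv.app U ≫ ω.hom := by simp [θ]
  have hω : ω.hom = (shiftFunctorAdd' C 1 d d' hd).hom.app U ≫ θ.hom⟦d⟧' := by simp [hθ]
  have hx : θ.hom ≫ x = -f⟦(1 : ℤ)⟧' := by
    have h₁ : ShiftedHom.comp ω.hom x hd = -f⟦d'⟧' := by
      rw [pow_succ, mul_neg_one, neg_smul] at hκ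
      obtain h | h := neg_one_pow_eq_or ℤ k
      · rw [h, one_smul, one_smul] at hκ
        rw [hκ, neg_neg]
      · simp only [h, neg_smul, one_smul, neg_neg] at hκ
        exact hκ.symm
    rw [hω, map_shift_comp, ← comp_shiftFunctorAdd'_hom hd, ← ShiftedHom.comp_neg] at h₁
    simp only [ShiftedHom.comp, NatIso.cancel_natIso_hom_left] at h₁
    exact (shiftFunctor C d).map_injective ((cancel_mono _).mp h₁)
  have hT' : Triangle.mk f b (e ≫ θ.inv) ∈ distTriang C :=
    dist_rotate_iff.mpr (dist_of_iso hT (Iso.refl _) (Iso.refl _) θ.symm (by simp) (by simp) (by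
      simp [← cancel_epi θ.hom, hx]))
  have := SplK.splice hd f b _ hT' c κ hcκ
  convert this using 1
  have hθ' : ω.hom ≫ θ.inv⟦d⟧' = (shiftFunctorAdd' C 1 d d' hd).hom.app U := by
    rw [hω, Category.assoc, ← Functor.map_comp, θ.hom_inv_id]
    simp
  rw [← map_shift_comp, ← hζ, ShiftedHom.comp, Category.assoc, reassoc_of% hθ']
  simp

end

end SplK

/-! ### Axioms (F2) and (F4) for the standard angles. -/

section

variable {C : Type u} [Category.{v} C] [Preadditive C] [HasZeroObject C] [HasShift C ℤ]
  [∀ m : ℤ, (shiftFunctor C m).Additive] [Pretriangulated C]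
  {F : ObjectProperty C} {D : ℤ} {hS : ∀ X : C, F X → F (X⟦D⟧)}

lemma snoc_mem_standardAngles_iff {k : ℕ} {X Z : F.FullSubcategory} (c : Chain Z (k + 2) X)
    (g : Z ⟶ (restrictedShift F D hS).obj X) :
    NSeq.mk X (c.snoc g) ∈ standardAngles F D hS (k + 3) ↔
      SplK (c.map F.ι) (F.ι.map g : ShiftedHom Z.obj X.obj D) := by
  let G : Z.obj ⟶ X.obj⟦D⟧ := F.ι.map g
  have e : (c.snoc g).map F.ι = (c.map F.ι).snoc (W := X.obj⟦D⟧) (G ≫ 𝟙 _) :=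
    (c.map_snoc F.ι g).trans (congrArg (fun t => Chain.snoc (W := X.obj⟦D⟧) t (c.map F.ι))
      (Category.comp_id G).symm)
  change IsSpliced (𝟙 (X.obj⟦D⟧)) ((c.snoc g).map F.ι) ↔ SplK (c.map F.ι) (G : ShiftedHom _ _ D)
  refine (congrArg (fun t => IsSpliced (𝟙 (X.obj⟦D⟧)) t) e).to_iff.trans ⟨fun h => ?_,
    fun h => h.isSpliced_snoc _⟩
  obtain ⟨κ, hκ, hc⟩ := h.exists_splK
  rw [Category.comp_id, Category.comp_id] at hκ
  exact hκ ▸ hc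

variable [IsTriangulated C]

lemma mem_standardAngles_iff_rotate_mem {n : ℕ} (hn : 3 ≤ n) (X : NSeq (restrictedShift F D hS) n) :
    X ∈ standardAngles F D hS n ↔ X.rotate ∈ standardAngles F D hS n := by
  obtain ⟨k, rfl⟩ := Nat.exists_eq_add_of_le' hn
  obtain ⟨X₁, c⟩ := X
  obtain ⟨Z, c, g, rfl⟩ := c.exists_eq_snoc
  obtain _ | ⟨f, c⟩ := c
  refine (snoc_mem_standardAngles_iff _ _).trans (Iff.trans ?_
    (snoc_mem_standardAngles_iff (c.snoc g) _).symm)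
  -- The axiom has the sign (-1)ⁿ with n = k + 3, while `left_rotate` counts the k + 1 morphisms of
  -- c.
  have e : (-1 : ℤ) ^ (k + 3) = (-1 : ℤ) ^ (k + 1) := by
    rw [pow_add, pow_add]; norm_num
  have e₂ : F.ι.map ((-1 : ℤ) ^ (k + 3) • (restrictedShift F D hS).map f) =
      (-1 : ℤ) ^ (k + 1) • (F.ι.map f)⟦D⟧' := by
    rw [Functor.map_zsmul, e]
    rfl
  rw [Chain.map_snoc]
  refine ⟨fun h => ?_, fun h => SplK.of_left_rotate ?_⟩
  · exact (congrArg (SplK _) e₂).mpr h.left_rotate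
  · exact (congrArg (SplK _) e₂).mp h

lemma exists_hom_cone_mem [HasBinaryBiproducts F.FullSubcategory]
    (hF : ∀ X Y : C, F X → F Y → ∀ j : ℤ, 0 < j → j < D → ∀ f : X ⟶ Y⟦j⟧, f = 0)
    {n : ℕ} (hn : 3 ≤ n) {X Y : NSeq (restrictedShift F D hS) n} (hX : X ∈ standardAngles F D hS n)
    (hY : Y ∈ standardAngles F D hS n) (φ₁ : X.X₁ ⟶ Y.X₁)
    (φ₂ : X.chain.second ⟶ Y.chain.second) (w : X.chain.head ≫ φ₂ = φ₁ ≫ Y.chain.head) :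
    ∃ φ : NSeq.Hom X Y φ₁, φ.second = φ₂ ∧ NSeq.Hom.cone φ ∈ standardAngles F D hS n := by
  obtain ⟨k, rfl⟩ := Nat.exists_eq_add_of_le' hn
  let G := restrictedShift F D hS
  obtain ⟨X₁, cX⟩ := X
  obtain _ | @⟨_, _, X₂, α₁, cX⟩ := cX
  -- The cone starts with X₂ ⊞ Y₁, so X enters through its left rotation, while Y is used as it
  -- stands.
  have hX'' : SplK (cX.map F.ι) ((-1 : ℤ) ^ (k + 1) • (F.ι.map α₁)⟦D⟧' :
      ShiftedHom (F.ι.obj X₁⟦D⟧) (F.ι.obj X₂) D) := by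
    obtain ⟨Z, c, g, rfl⟩ := cX.exists_eq_snoc
    have h := ((snoc_mem_standardAngles_iff (Chain.cons α₁ c) g).mp hX).left_rotate
    exact (congrArg (fun t => SplK t _) (c.map_snoc F.ι g)).mpr h
  obtain _ | @⟨_, _, X₃, α₂, cX⟩ := cX
  obtain ⟨Y₁, cY⟩ := Y
  obtain ⟨Z', cY, g', rfl⟩ := cY.exists_eq_snoc
  obtain _ | @⟨_, _, Y₂, β₁, cY⟩ := cY
  have hY' := (snoc_mem_standardAngles_iff _ _).mp hY
  change X₂ ⟶ Y₂ at φ₂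
  change α₁ ≫ φ₂ = φ₁ ≫ β₁ at w
  let S := (SumData.ofBiprod X₂ Y₁).map F.ι
  have hN : Triangle.mk S.inr S.fst (0 : X₂.obj ⟶ Y₁.obj⟦(1 : ℤ)⟧) ∈ distTriang C := by
    let e : Y₁.obj ⊞ X₂.obj ≅ (X₂ ⊞ Y₁).obj :=
      { hom := biprod.fst ≫ S.inr + biprod.snd ≫ S.inl
        inv := S.snd ≫ biprod.inl + S.fst ≫ biprod.inr
        hom_inv_id := by
          apply biprod.hom_ext' <;> simp
        inv_hom_id := by
          apply S.hom_ext_src <;> simp }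
    exact dist_of_iso (binaryBiproductTriangle_distinguished Y₁.obj X₂.obj) (Iso.refl _) e
      (Iso.refl _) (by simp [e]) (by simp [e]) (by simp)
  let l : G.obj X₁ ⟶ G.obj (X₂ ⊞ Y₁) :=
    -(G.map α₁ ≫ G.map biprod.inl) + G.map φ₁ ≫ G.map biprod.inr
  have hl : l ≫ G.map (biprod.desc φ₂ β₁) = 0 := by
    simp only [l, Preadditive.add_comp, Preadditive.neg_comp, Category.assoc, ← Functor.map_comp,
      biprod.inl_desc, biprod.inr_desc, w, neg_add_cancel]
  have hl₁ : l ≫ G.map biprod.fst = -G.map α₁ := by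
    simp only [l, Preadditive.add_comp, Preadditive.neg_comp, Category.assoc, ← Functor.map_comp,
      biprod.inl_fst, biprod.inr_fst, comp_zero, Functor.map_zero, add_zero, Category.comp_id]
  have hl₂ : l ≫ G.map biprod.snd = G.map φ₁ := by
    simp only [l, Preadditive.add_comp, Preadditive.neg_comp, Category.assoc, ← Functor.map_comp,
      biprod.inl_snd, biprod.inr_snd, comp_zero, Functor.map_zero, neg_zero, zero_add,
      Category.comp_id]
  let τ : (F.ι.obj (X₂ ⊞ Y₁))⟦D⟧ ⟶ F.ι.obj (G.obj (X₂ ⊞ Y₁)) := 𝟙 _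
  obtain ⟨m, φ, h⟩ := exists_hom_cone_spl hF cX cY (F.ι.map α₂) (F.ι.map β₁) le_rfl hX'' hY' hN
    (F.ι.map (biprod.desc φ₂ β₁)) ((F.ι.map_comp _ _).symm.trans
      (congrArg F.ι.map (biprod.inr_desc _ _)))
    (G.map φ₁) (G.map biprod.snd) l (G.map biprod.inr)
    (by rw [← G.map_comp, biprod.inr_snd, G.map_id]) hl₂ τ g' (F.ι.map l) (Category.comp_id _)
    (congrArg F.ι.map hl) (by
      refine (congrArg F.ι.map hl₁).trans ?_
      -- The sign of the invariant and that of the rotation multiply to -1, matching the entry -Σα₁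
      -- of l.
      rw [smul_smul, ← pow_add, show k + 1 + 1 + (k + 1) = 2 * (k + 1) + 1 by ring, pow_succ,
        pow_mul]
      simp only [Int.reduceNeg, even_two, Even.neg_pow, one_pow, one_mul, neg_smul, one_smul]
      rfl)
    ((congrArg (F.ι.map g' ≫ ·) (Category.comp_id _)).trans (F.ι.map_comp _ _).symm)
  have e₀ : biprod.desc (biprod.lift (-α₂) φ₂) (biprod.lift 0 β₁) =
      -(biprod.fst ≫ α₂ ≫ biprod.inl) + biprod.desc φ₂ β₁ ≫ biprod.inr := by
    apply biprod.hom_ext' <;> apply biprod.hom_ext <;> simp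
  have e₁ : -(S.fst ≫ F.ι.map α₂ ≫ F.ι.map biprod.inl) +
      F.ι.map (biprod.desc φ₂ β₁) ≫ F.ι.map biprod.inr =
        F.ι.map (biprod.desc (biprod.lift (-α₂) φ₂) (biprod.lift 0 β₁)) := by
    rw [e₀, Functor.map_add, Functor.map_neg, Functor.map_comp, Functor.map_comp, Functor.map_comp]
    rfl
  have h' := (congrArg (fun t => Spl _ (Chain.cons t _)) e₁).mp h
  have sq : α₂ ≫ m = φ₂ ≫ cY.head :=
    comp_eq_of_cone_comp_eq_zero (F.ι.map_injective ((F.ι.map_comp _ _).trans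
      (h'.comp_eq_zero.trans (F.ι.map_zero _ _).symm)))
  refine ⟨Chain.Hom.cons φ₂ w (Chain.Hom.consSnoc φ₂ m sq φ), rfl, ?_⟩
  have e := Chain.Hom.cone_consSnoc φ₂ m sq φ l (G.map biprod.inr)
  exact ((congrArg (fun t => Spl τ (Chain.map F.ι
    (Chain.cons (biprod.desc (biprod.lift (-α₂) φ₂) (biprod.lift 0 β₁)) t))) e).mpr h').isSpliced

end

/-! ### Cluster tilting subcategories closed under the d-fold shift. -/

section

variable {C : Type u} [Category.{v} C] [Preadditive C] [HasShift C ℤ]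
  [∀ m : ℤ, (shiftFunctor C m).Additive]

lemma eq_zero_of_shift_hom_eq_zero {U Y : C} {a b n : ℤ} (h : a + n = b)
    (H : ∀ f : U⟦n⟧ ⟶ Y⟦b⟧, f = 0) (f : U ⟶ Y⟦a⟧) : f = 0 := by
  refine (shiftFunctor C n).map_injective ?_
  rw [Functor.map_zero, ← cancel_mono ((shiftFunctorAdd' C a n b h).inv.app Y), zero_comp]
  exact H _

lemma shift_hom_eq_zero {U Y : C} {a b n : ℤ} (h : a + n = b)
    (H : ∀ f : U ⟶ Y⟦a⟧, f = 0) (f : U⟦n⟧ ⟶ Y⟦b⟧) : f = 0 := by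
  obtain ⟨g, hg⟩ := (shiftFunctor C n).map_surjective
    (f ≫ (shiftFunctorAdd' C a n b h).hom.app Y)
  rw [← cancel_mono ((shiftFunctorAdd' C a n b h).hom.app Y), ← hg, H g, Functor.map_zero,
    zero_comp]

lemma shift_hom_eq_zero' {U Y : C} {a n : ℤ} (h : a + n = 0)
    (H : ∀ f : U ⟶ Y⟦a⟧, f = 0) (f : U⟦n⟧ ⟶ Y) : f = 0 := by
  rw [← cancel_mono ((shiftFunctorZero C ℤ).inv.app Y), zero_comp]
  exact shift_hom_eq_zero h H _

namespace IsClusterTilting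

variable {d : ℕ} {F : ObjectProperty C}

lemma hom_eq_zero (hF : IsClusterTilting d F) (X Y : C) (hX : F X) (hY : F Y) (j : ℤ) (h₀ : 0 < j)
    (hj : j < d) (f : X ⟶ Y⟦j⟧) : f = 0 := by
  lift j to ℕ using h₀.le
  exact (hF.iff_right Y).mp hY X hX j (by omega) (by omega) f

lemma of_sumData (hF : IsClusterTilting d F) {X Y B : C} (S : SumData X Y B) (hX : F X)
    (hY : F Y) : F B := by
  refine (hF.iff_right B).mpr fun G hG i h₀ hi f => ?_
  refine (S.map (shiftFunctor C (i : ℤ))).hom_ext_tgt ?_ ?_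
  · rw [zero_comp]
    exact (hF.iff_right X).mp hX G hG i h₀ hi _
  · rw [zero_comp]
    exact (hF.iff_right Y).mp hY G hG i h₀ hi _

lemma of_isZero (hF : IsClusterTilting d F) {X : C} (hX : IsZero X) : F X :=
  (hF.iff_right X).mpr fun _ _ i _ _ _ => ((shiftFunctor C (i : ℤ)).map_isZero hX).eq_of_tgt _ _

/-- Hom(G, X⟦-d⟧⟦i⟧) is Hom(G⟦d⟧, X⟦i⟧), which vanishes because G⟦d⟧ lies in F. This gives essential
surjectivity of the restricted shift. -/
lemma shift_neg (hF : IsClusterTilting d F) (hS : ∀ X : C, F X → F (X⟦(d : ℤ)⟧)) {X : C}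
    (hX : F X) : F (X⟦(-d : ℤ)⟧) := by
  refine (hF.iff_right _).mpr fun G hG i h₀ hi f => ?_
  rw [← cancel_mono ((shiftFunctorAdd' C (-d : ℤ) i _ rfl).inv.app X), zero_comp]
  exact eq_zero_of_shift_hom_eq_zero (n := d) (b := i) (by ring)
    ((hF.iff_right X).mp hX _ (hS G hG) i h₀ hi) _

/-- Shifting by d turns the degree j into j + d, strictly between 0 and d, with source X⟦d⟧ still in
F. Needed for direct summands. -/
lemma hom_eq_zero_of_neg (hF : IsClusterTilting d F) (hS : ∀ X : C, F X → F (X⟦(d : ℤ)⟧))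
    (X Y : C) (hX : F X) (hY : F Y) (j : ℤ) (h₀ : j < 0) (hj : -d < j) (f : X ⟶ Y⟦j⟧) : f = 0 :=
  eq_zero_of_shift_hom_eq_zero (n := d) rfl
    (hF.hom_eq_zero _ _ (hS X hX) hY _ (by omega) (by omega)) f

lemma hasZeroObject [HasZeroObject C] (hF : IsClusterTilting d F) :
    HasZeroObject F.FullSubcategory :=
  ⟨⟨⟨(0 : C), hF.of_isZero (isZero_zero C)⟩, (IsZero.iff_id_eq_zero _).mpr
    (F.ι.map_injective ((isZero_zero C).eq_of_src _ _))⟩⟩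

lemma hasBinaryBiproducts [HasBinaryBiproducts C] (hF : IsClusterTilting d F) :
    HasBinaryBiproducts F.FullSubcategory where
  has_binary_biproduct X Y := by
    let B : F.FullSubcategory :=
      ⟨X.obj ⊞ Y.obj, hF.of_sumData (SumData.ofBiprod X.obj Y.obj) X.property Y.property⟩
    let b : BinaryBicone X Y :=
      { pt := B
        fst := ⟨biprod.fst⟩
        snd := ⟨biprod.snd⟩
        inl := ⟨biprod.inl⟩
        inr := ⟨biprod.inr⟩
        inl_fst := F.ι.map_injective biprod.inl_fst
        inl_snd := F.ι.map_injective biprod.inl_snd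
        inr_fst := F.ι.map_injective biprod.inr_fst
        inr_snd := F.ι.map_injective biprod.inr_snd }
    exact hasBinaryBiproduct_of_total b (F.ι.map_injective biprod.total)

lemma isEquivalence_restrictedShift (hF : IsClusterTilting d F)
    (hS : ∀ X : C, F X → F (X⟦(d : ℤ)⟧)) : (restrictedShift F (d : ℤ) hS).IsEquivalence where
  faithful := inferInstance
  full := inferInstance
  essSurj := ⟨fun Y => ⟨⟨Y.obj⟦(-d : ℤ)⟧, hF.shift_neg hS Y.property⟩,
    ⟨F.ι.preimageIso ((shiftFunctorCompIsoId C (-d : ℤ) d (by ring)).app Y.obj)⟩⟩⟩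

end IsClusterTilting

end

/-! ### Trivial angles and existence of angles. -/

section

variable {C : Type u} [Category.{v} C] [Preadditive C] [HasZeroObject C] [HasShift C ℤ]
  [∀ m : ℤ, (shiftFunctor C m).Additive] [Pretriangulated C] {F : ObjectProperty C}

lemma Inner.precomp {Z U V : C} {k : ℕ} (p : U ⟶ V) {c : Chain Z k V} (h : Inner F c) :
    Inner F (c.precomp p) := by
  cases c <;> exact h

lemma Inner.target {Z U : C} {k : ℕ} {c : Chain Z k U} (h : Inner F c) : F Z := by
  induction c with
  | single f => exact h
  | cons f c ih => exact ih h.2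

lemma Inner.exists_lift {Z U : C} {k : ℕ} {c : Chain Z k U} (h : Inner F c) (hZ : F Z)
    {X : F.FullSubcategory} (p : F.ι.obj X ⟶ U) :
    ∃ c' : Chain (⟨Z, hZ⟩ : F.FullSubcategory) k X, c'.map F.ι = c.precomp p := by
  induction c generalizing X with
  | @single U f => exact ⟨Chain.single ⟨p ≫ f⟩, rfl⟩
  | @cons k U Y f c ih =>
    let Y' : F.FullSubcategory := ⟨Y, h.1⟩
    obtain ⟨c', hc'⟩ := ih h.2 (X := Y') (𝟙 _)
    refine ⟨Chain.cons (⟨p ≫ f⟩ : X ⟶ Y') c', ?_⟩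
    have : c.precomp (𝟙 _) = c := by cases c <;> simp
    exact congrArg (Chain.cons (p ≫ f)) (hc'.trans this)

section

variable [HasZeroObject F.FullSubcategory]

lemma isZero_ι_obj_zero : IsZero (F.ι.obj (0 : F.FullSubcategory)) :=
  F.ι.map_isZero (isZero_zero _)

lemma dist_of_isZero {X Y Z : C} (hX : IsZero X) (hY : IsZero Y) (hZ : IsZero Z) :
    Triangle.mk (0 : X ⟶ Y) (0 : Y ⟶ Z) (0 : Z ⟶ X⟦(1 : ℤ)⟧) ∈ distTriang C :=
  dist_of_iso (contractible_distinguished X) (Iso.refl _) (hX.iso hY) ((isZero_zero C).iso hZ)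
    (hX.eq_of_src _ _) (hX.eq_of_src _ _) ((isZero_zero C).eq_of_src _ _)

lemma spl_zeros {W : F.FullSubcategory} {k : ℕ} {U : C} (hU : IsZero U)
    (q : U ⟶ F.ι.obj (0 : F.FullSubcategory)) {d : ℤ} (hd : d = k) (t : U⟦d⟧ ⟶ F.ι.obj W) :
    Spl t (Chain.cons q ((Chain.zeros W k (0 : F.FullSubcategory)).map F.ι)) := by
  have h₀ := isZero_ι_obj_zero (F := F)
  induction k generalizing U d with
  | zero =>
    obtain rfl : d = 0 := hd
    obtain rfl : (hU.iso h₀).hom = q := hU.eq_of_src _ _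
    exact Spl.base _ _ _ (h₀.eq_of_src _ _)
  | succ k ih =>
    have := Spl.splice (show (1 : ℤ) + k = d by rw [hd]; push_cast; ring) _ _ _
      (dist_of_isZero hU h₀ h₀) _ t (ih h₀ 0 rfl _)
    rw [Chain.precomp_cons] at this
    convert this using 2
    · exact hU.eq_of_src _ _
    · exact congrArg (fun t => Chain.cons t _) (h₀.eq_of_src _ _)

lemma trivial_mem_standardAngles {k : ℕ} {hS : ∀ X : C, F X → F (X⟦((k + 1 : ℕ) : ℤ)⟧)}
    (h : 2 ≤ k + 3) (X : F.FullSubcategory) :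
    NSeq.trivial (restrictedShift F _ hS) (k + 3) h X ∈ standardAngles F _ hS (k + 3) := by
  have h₀ := isZero_ι_obj_zero (F := F)
  have hT : Triangle.mk (𝟙 (F.ι.obj X)) (0 : _ ⟶ F.ι.obj (0 : F.FullSubcategory)) 0 ∈
      distTriang C :=
    dist_of_iso (contractible_distinguished (F.ι.obj X)) (Iso.refl _) (Iso.refl _)
      ((isZero_zero C).iso h₀) (by simp) (by simp) (by simp)
  let τ : (F.ι.obj X)⟦((k + 1 : ℕ) : ℤ)⟧ ⟶ F.ι.obj ((restrictedShift F _ hS).obj X) := 𝟙 _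
  have := Spl.splice (show (1 : ℤ) + k = ((k + 1 : ℕ) : ℤ) by push_cast; ring) _ _ _ hT _ τ
    (spl_zeros (k := k) h₀ 0 rfl _)
  rw [Chain.precomp_cons] at this
  refine Eq.mp ?_ this.isSpliced
  refine congrArg (IsSpliced τ) (congrArg₂ Chain.cons (F.ι.map_id X).symm
    (congrArg (fun t => Chain.cons t _) ?_))
  exact h₀.eq_of_tgt _ _

end

section

variable {d : ℕ}

/-- An object of the ambient category with only one non-vanishing positive degree of morphisms to
`F` has a coresolution by objects of `F`. -/
lemma IsClusterTilting.exists_coresolution (hF : IsClusterTilting d F) {e k : ℕ} (hk : 0 < k)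
    (hd : k + e = d) {V : C}
    (hV : ∀ G, F G → ∀ j : ℤ, 0 < j → j < d → j ≠ k → ∀ f : V ⟶ G⟦j⟧, f = 0) :
    ∃ (Z : C) (c : Chain Z (e + 1) V) (κ : ShiftedHom Z V (e : ℤ)), SplK c κ ∧ Inner F c := by
  induction e generalizing k V with
  | zero =>
    -- Here k = d, so the exceptional degree is outside the range and V lies in F.
    refine ⟨V, _, _, SplK.base (Iso.refl V), (hF.iff_left V).mpr fun G hG i h₀ hi f => ?_⟩
    exact hV G hG i (by omega) (by omega) (by omega) f
  | succ e ih =>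
    -- For the cone V', degree 1 vanishes because every V ⟶ G factors through i, and degree j > 1
    -- comes from degree j - 1 of V. The exceptional degree thus moves to k + 1.
    obtain ⟨Y, i, hY, hi⟩ := hF.covariantlyFinite V
    obtain ⟨V', p, h, hT⟩ := distinguished_cocone_triangle i
    obtain ⟨Z, c, κ, hc, hc'⟩ := ih (V := V') (k := k + 1) (by omega) (by omega) (by
      intro G hG j h₀ hj hjk f
      obtain ⟨b, rfl⟩ := dist_yoneda₃ hT f (hF.hom_eq_zero _ _ hY hG j h₀ hj _)
      obtain rfl | hj₁ := eq_or_ne j 1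
      · obtain ⟨a, rfl⟩ := (shiftFunctor C (1 : ℤ)).map_surjective b
        obtain ⟨a, rfl⟩ := hi G hG a
        rw [Functor.map_comp, reassoc_of% dist_zero₃₁ hT, zero_comp]
      · rw [shift_hom_eq_zero (a := j - 1) (by ring) (hV G hG (j - 1) (by omega) (by omega)
          (by push_cast at hjk; omega)) b, comp_zero])
    exact ⟨Z, _, _, SplK.splice (by push_cast; ring) i p h hT c κ hc, hY, hc'.precomp p⟩

lemma IsClusterTilting.exists_mem_standardAngles {k : ℕ} (hF : IsClusterTilting (k + 1) F)
    {hS : ∀ X : C, F X → F (X⟦((k + 1 : ℕ) : ℤ)⟧)} {X₁ X₂ : F.FullSubcategory} (α₁ : X₁ ⟶ X₂) :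
    ∃ c : Chain ((restrictedShift F _ hS).obj X₁) (k + 3) X₁, c.StartsWith α₁ ∧
      NSeq.mk X₁ c ∈ standardAngles F _ hS (k + 3) := by
  obtain ⟨V, p, h, hT⟩ := distinguished_cocone_triangle (F.ι.map α₁)
  -- The exceptional degree of a cone of a morphism in F is 1, so k further triangles suffice.
  obtain ⟨Z, c, κ, hc, hi⟩ := hF.exists_coresolution (V := V) (k := 1) (e := k) one_pos
    (by omega) (by
      intro G hG j h₀ hj hj₁ f
      obtain ⟨b, rfl⟩ := dist_yoneda₃ hT f (hF.hom_eq_zero _ _ X₂.property hG j h₀ hj _)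
      rw [shift_hom_eq_zero (a := j - 1) (by ring) (hF.hom_eq_zero _ _ X₁.property hG (j - 1)
        (by push_cast at hj₁; omega) (by omega)) b, comp_zero])
  obtain ⟨c', hc'⟩ := hi.exists_lift hi.target p
  have hd : (1 : ℤ) + k = ((k + 1 : ℕ) : ℤ) := by push_cast; ring
  let g : (⟨Z, hi.target⟩ : F.FullSubcategory) ⟶ (restrictedShift F _ hS).obj X₁ :=
    ⟨κ.comp h hd⟩
  refine ⟨(Chain.cons α₁ c').snoc g, Chain.StartsWith.intro _ _,
    (snoc_mem_standardAngles_iff (Chain.cons α₁ c') g).mpr ?_⟩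
  have := SplK.splice hd _ p h hT c κ hc
  rw [← hc'] at this
  exact this

end

end

/-! ### Direct sums of angles. -/

/-- The isomorphism of biproducts induced by two isomorphisms. -/
@[simps]
def SumData.mapIso {A : Type u'} [Category.{v'} A] [Preadditive A] {X Y B X' Y' B' : A}
    (S : SumData X Y B) (S' : SumData X' Y' B') (e : X ≅ X') (e' : Y ≅ Y') : B ≅ B' where
  hom := S.fst ≫ e.hom ≫ S'.inl + S.snd ≫ e'.hom ≫ S'.inr
  inv := S'.fst ≫ e.inv ≫ S.inl + S'.snd ≫ e'.inv ≫ S.inr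
  hom_inv_id := by apply S.hom_ext_src <;> simp
  inv_hom_id := by apply S'.hom_ext_src <;> simp

lemma Chain.sum_snoc {A : Type u} [Category.{v} A] [Preadditive A] [HasBinaryBiproducts A]
    {Z Z' V V' W : A} (g : Z ⟶ V) (g' : Z' ⟶ V') (l : V ⟶ W) (r : V' ⟶ W) {n : ℕ} {X X' : A}
    (c : Chain Z n X) (c' : Chain Z' n X') :
    Chain.sum l r (c.snoc g) (c'.snoc g') =
      (Chain.sum biprod.inl biprod.inr c c').snoc (biprod.desc (g ≫ l) (g' ≫ r)) := by
  induction n generalizing X X' with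
  | zero => nomatch c
  | succ n ih =>
    obtain f | ⟨f, c⟩ := c
    · obtain f' | ⟨_, c'⟩ := c'
      · refine congrArg₂ Chain.cons ?_ rfl
        apply biprod.hom_ext' <;> simp
      · nomatch c'
    · obtain f' | ⟨f', c'⟩ := c'
      · nomatch c
      · exact congrArg (Chain.cons _) (ih c c')

section

variable {C : Type u} [Category.{v} C] [Preadditive C] [HasZeroObject C] [HasShift C ℤ]
  [∀ m : ℤ, (shiftFunctor C m).Additive] [Pretriangulated C] {F : ObjectProperty C}
  [HasBinaryBiproducts F.FullSubcategory]

lemma ι_map_biprod_map {X Q X' Q' : F.FullSubcategory} (g : X ⟶ X') (g' : Q ⟶ Q') :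
    F.ι.map (biprod.map g g') = F.ι.map biprod.fst ≫ F.ι.map g ≫ F.ι.map biprod.inl +
      F.ι.map biprod.snd ≫ F.ι.map g' ≫ F.ι.map biprod.inr := by
  have : biprod.map g g' = biprod.fst ≫ g ≫ biprod.inl + biprod.snd ≫ g' ≫ biprod.inr := by
    apply biprod.hom_ext <;> simp
  rw [this]
  simp only [Functor.map_add, Functor.map_comp]

namespace SplK

/-- The triangles are added one by one. Cosyzygies use biproducts of the ambient category and chain
objects the images of biproducts in F; `SumData` treats both alike. -/
lemma sum {k : ℕ} {X Q Z Z' : F.FullSubcategory} (c : Chain Z k X) (c' : Chain Z' k Q)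
    {M P N : C} {f : M ⟶ F.ι.obj X} {f' : P ⟶ F.ι.obj Q} {d : ℤ}
    {κ : ShiftedHom (F.ι.obj Z) M d} {κ' : ShiftedHom (F.ι.obj Z') P d}
    (hc : SplK (Chain.cons f (c.map F.ι)) κ) (hc' : SplK (Chain.cons f' (c'.map F.ι)) κ')
    (S : SumData M P N) :
    SplK (Chain.cons (S.fst ≫ f ≫ F.ι.map biprod.inl + S.snd ≫ f' ≫ F.ι.map biprod.inr)
      ((Chain.sum biprod.inl biprod.inr c c').map F.ι))
      (F.ι.map biprod.fst ≫ κ ≫ S.inl⟦d⟧' + F.ι.map biprod.snd ≫ κ' ≫ S.inr⟦d⟧') := by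
  induction k generalizing X Q M P N d with
  | zero => nomatch c
  | succ k ih =>
    obtain ⟨M', p, h, d₁, hd, c₁, κ₁, hM, hc₁, rfl, hκ₁⟩ := hc.exists_of_cons
    obtain ⟨P', p', h', d₁', hd', c₁', κ₁', hP, hc₁', rfl, hκ₁'⟩ := hc'.exists_of_cons
    obtain rfl : d₁' = d₁ := by omega
    let S' := SumData.ofBiprod M' P'
    have hT := dist_sum hM hP S ((SumData.ofBiprod X Q).map F.ι) S'
    obtain ⟨c₂, κ₂, e₁, e₂, hs⟩ : ∃ (c₂ : Chain (F.ι.obj (Z ⊞ Z')) (k + 1) (M' ⊞ P'))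
        (κ₂ : ShiftedHom (F.ι.obj (Z ⊞ Z')) (M' ⊞ P') d₁'),
        c₂.precomp (((SumData.ofBiprod X Q).map F.ι).fst ≫ p ≫ S'.inl +
          ((SumData.ofBiprod X Q).map F.ι).snd ≫ p' ≫ S'.inr) =
            (Chain.sum biprod.inl biprod.inr c c').map F.ι ∧
        κ₂ = F.ι.map biprod.fst ≫ κ₁ ≫ S'.inl⟦d₁'⟧' + F.ι.map biprod.snd ≫ κ₁' ≫ S'.inr⟦d₁'⟧' ∧
        SplK c₂ κ₂ := by
      obtain g | @⟨_, _, X₂, g, c₂⟩ := c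
      · obtain g' | ⟨_, c₂'⟩ := c'
        swap
        · nomatch c₂'
        obtain f₁ | ⟨_, c₁⟩ := c₁
        swap
        · nomatch c₁
        obtain f₁' | ⟨_, c₁'⟩ := c₁'
        swap
        · nomatch c₁'
        obtain ⟨e, rfl, rfl, rfl⟩ := hκ₁.exists_of_single
        obtain ⟨e', hd₀, rfl, rfl⟩ := hκ₁'.exists_of_single
        have hg : F.ι.map g = p ≫ e.hom := Chain.single.inj hc₁
        have hg' : F.ι.map g' = p' ≫ e'.hom := Chain.single.inj hc₁'
        refine ⟨_, _, ?_, ?_, SplK.base (S'.mapIso ((SumData.ofBiprod Z Z').map F.ι) e e')⟩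
        · have e₀ : biprod.desc (g ≫ biprod.inl) (g' ≫ biprod.inr) = biprod.map g g' := by
            apply biprod.hom_ext' <;> simp
          refine congrArg Chain.single (Eq.trans ?_ (congrArg F.ι.map e₀).symm)
          rw [ι_map_biprod_map, hg, hg']
          simp
        · rw [mk₀_comp_map_shift, mk₀_comp_map_shift]
          simp [ShiftedHom.mk₀]
      · obtain g' | @⟨_, _, Q₂, g', c₂'⟩ := c'
        · nomatch c₂
        obtain f₁ | @⟨_, _, _, f₁, c₁⟩ := c₁
        · nomatch c₂
        obtain f₁' | @⟨_, _, _, f₁', c₁'⟩ := c₁'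
        · nomatch c₂
        obtain ⟨rfl, hg, hc₁⟩ := Chain.cons.inj hc₁
        obtain ⟨rfl, hg', hc₁'⟩ := Chain.cons.inj hc₁'
        obtain rfl := eq_of_heq hc₁
        obtain rfl := eq_of_heq hc₁'
        replace hg := eq_of_heq hg
        replace hg' := eq_of_heq hg'
        refine ⟨_, _, ?_, rfl, ih c₂ c₂' hκ₁ hκ₁' S'⟩
        refine congrArg (fun t => Chain.cons t _) (Eq.trans ?_ (ι_map_biprod_map g g').symm)
        rw [hg, hg']
        simp
    have key := SplK.splice hd _ _ _ hT c₂ κ₂ hs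
    have e₃ : κ₂.comp (S'.fst ≫ h ≫ S.inl⟦(1 : ℤ)⟧' + S'.snd ≫ h' ≫ S.inr⟦(1 : ℤ)⟧') hd =
        F.ι.map biprod.fst ≫ κ₁.comp h hd ≫ S.inl⟦d⟧' +
          F.ι.map biprod.snd ≫ κ₁'.comp h' hd' ≫ S.inr⟦d⟧' := by
      rw [e₂, ShiftedHom.add_comp, ← Category.assoc, ← Category.assoc (F.ι.map biprod.snd),
        map_shift_comp, map_shift_comp, comp_map_shift, comp_map_shift]
      simp only [Preadditive.comp_add, S'.inl_fst_assoc, S'.inl_snd_assoc, S'.inr_fst_assoc,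
        S'.inr_snd_assoc, zero_comp, add_zero, zero_add]
      simp [ShiftedHom.comp]
    rw [e₁, e₃] at key
    exact key

end SplK

lemma sum_mem_standardAngles {D : ℤ} {hS : ∀ X : C, F X → F (X⟦D⟧)} {n : ℕ} (hn : 3 ≤ n)
    {X Y : NSeq (restrictedShift F D hS) n} (hX : X ∈ standardAngles F D hS n)
    (hY : Y ∈ standardAngles F D hS n) : X.sum Y ∈ standardAngles F D hS n := by
  obtain ⟨k, rfl⟩ := Nat.exists_eq_add_of_le' hn
  obtain ⟨X₁, cX⟩ := X
  obtain ⟨Y₁, cY⟩ := Y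
  obtain ⟨Z, cX, g, rfl⟩ := cX.exists_eq_snoc
  obtain ⟨Z', cY, g', rfl⟩ := cY.exists_eq_snoc
  have hX' := (snoc_mem_standardAngles_iff _ _).mp hX
  have hY' := (snoc_mem_standardAngles_iff _ _).mp hY
  obtain _ | ⟨α, cX⟩ := cX
  obtain _ | ⟨β, cY⟩ := cY
  let G := restrictedShift F D hS
  have e := Chain.sum_snoc g g' (G.map biprod.inl) (G.map biprod.inr) (Chain.cons α cX)
    (Chain.cons β cY)
  have := SplK.sum cX cY hX' hY' ((SumData.ofBiprod X₁ Y₁).map F.ι)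
  change NSeq.mk (X₁ ⊞ Y₁) (Chain.sum (G.map biprod.inl) (G.map biprod.inr)
    ((Chain.cons α cX).snoc g) ((Chain.cons β cY).snoc g')) ∈ _
  rw [e]
  refine (snoc_mem_standardAngles_iff _ _).mpr ?_
  have e₁ : biprod.desc (g ≫ G.map biprod.inl) (g' ≫ G.map biprod.inr) =
      biprod.fst ≫ g ≫ G.map (biprod.inl : X₁ ⟶ X₁ ⊞ Y₁) +
        biprod.snd ≫ g' ≫ G.map (biprod.inr : Y₁ ⟶ X₁ ⊞ Y₁) := by
    apply biprod.hom_ext' <;> simp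
  have e₂ := ι_map_biprod_map α β
  have e₃ := congrArg F.ι.map e₁
  simp only [Functor.map_add, Functor.map_comp] at e₃
  refine (congrArg₂ (fun s t => SplK (d := D) (Chain.cons s _) t) e₂ e₃).mpr ?_
  exact this

end

/-! ### Direct summands of angles. -/

namespace Chain

/-- A chain that is a retract of another one, through the given retractions of the first
and of the last objects. -/
inductive IsRetract {A : Type u} [Category.{v} A] {W W' : A} (iW : W ⟶ W') (rW : W' ⟶ W) :
    {n : ℕ} → {X X' : A} → Chain W n X → Chain W' n X' → (X ⟶ X') → (X' ⟶ X) → Prop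
  | single {X X' : A} {f : X ⟶ W} {f' : X' ⟶ W'} {i : X ⟶ X'} {r : X' ⟶ X}
      (wi : f ≫ iW = i ≫ f') (wr : f' ≫ rW = r ≫ f) :
      IsRetract iW rW (Chain.single f) (Chain.single f') i r
  | cons {n : ℕ} {X X' Y Y' : A} {f : X ⟶ Y} {f' : X' ⟶ Y'} {c : Chain W n Y} {c' : Chain W' n Y'}
      {i : X ⟶ X'} {r : X' ⟶ X} (i₂ : Y ⟶ Y') (r₂ : Y' ⟶ Y) (h₂ : i₂ ≫ r₂ = 𝟙 Y)
      (wi : f ≫ i₂ = i ≫ f') (wr : f' ≫ r₂ = r ≫ f) (h : IsRetract iW rW c c' i₂ r₂) :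
      IsRetract iW rW (Chain.cons f c) (Chain.cons f' c') i r

namespace IsRetract

variable {A : Type u} [Category.{v} A]

lemma map {B : Type u'} [Category.{v'} B] (G : A ⥤ B) {W W' : A} {iW : W ⟶ W'} {rW : W' ⟶ W}
    {n : ℕ} {X X' : A} {c : Chain W n X} {c' : Chain W' n X'} {i : X ⟶ X'} {r : X' ⟶ X}
    (h : IsRetract iW rW c c' i r) :
    IsRetract (G.map iW) (G.map rW) (c.map G) (c'.map G) (G.map i) (G.map r) := by
  induction h with
  | single wi wr =>
    exact IsRetract.single (by rw [← G.map_comp, wi, G.map_comp])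
      (by rw [← G.map_comp, wr, G.map_comp])
  | cons i₂ r₂ h₂ wi wr h ih =>
    exact IsRetract.cons _ _ (by rw [← G.map_comp, h₂, G.map_id])
      (by rw [← G.map_comp, wi, G.map_comp]) (by rw [← G.map_comp, wr, G.map_comp]) ih

lemma exists_of_snoc {Z Z' W W' : A} {iW : W ⟶ W'} {rW : W' ⟶ W} {g : Z ⟶ W} {g' : Z' ⟶ W'}
    {n : ℕ} {X X' : A} {c : Chain Z n X} {c' : Chain Z' n X'} {i : X ⟶ X'} {r : X' ⟶ X}
    (h : IsRetract iW rW (c.snoc g) (c'.snoc g') i r) :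
    ∃ (iZ : Z ⟶ Z') (rZ : Z' ⟶ Z), iZ ≫ rZ = 𝟙 Z ∧ IsRetract iZ rZ c c' i r ∧
      g ≫ iW = iZ ≫ g' ∧ g' ≫ rW = rZ ≫ g := by
  induction n generalizing X X' with
  | zero => nomatch c
  | succ n ih =>
    obtain f | ⟨f, c⟩ := c
    · obtain f' | ⟨_, c'⟩ := c'
      swap
      · nomatch c'
      cases h with
      | cons i₂ r₂ h₂ wi wr h =>
        cases h with
        | single wi' wr' => exact ⟨i₂, r₂, h₂, .single wi wr, wi', wr'⟩
    · obtain f' | ⟨f', c'⟩ := c'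
      · nomatch c
      cases h with
      | cons i₂ r₂ h₂ wi wr h =>
        obtain ⟨iZ, rZ, h₁, h₃, h₄, h₅⟩ := ih h
        exact ⟨iZ, rZ, h₁, .cons i₂ r₂ h₂ wi wr h₃, h₄, h₅⟩

/-- The last object need not be a chosen biproduct, so s supplies its projection; in the application
s = Σ(fst). -/
lemma of_isIsomorphic [Preadditive A] [HasBinaryBiproducts A] {V V' W W' : A} {l : V ⟶ W}
    {r : V' ⟶ W} {s : W ⟶ V} (hl : l ≫ s = 𝟙 V) (hr : r ≫ s = 0) (b : W' ≅ W) {n : ℕ}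
    {X Y Z : A} {cX : Chain V n X} {cY : Chain V' n Y} {cZ : Chain W' n Z} {a : Z ≅ X ⊞ Y}
    (h : IsIsomorphic b cZ (Chain.sum l r cX cY) a) :
    IsRetract (l ≫ b.inv) (b.hom ≫ s) cX cZ (biprod.inl ≫ a.inv) (a.hom ≫ biprod.fst) := by
  induction n generalizing X Y Z with
  | zero => nomatch cX
  | succ n ih =>
    obtain f | ⟨f, cX⟩ := cX
    · obtain f' | ⟨_, cY⟩ := cY
      swap
      · nomatch cY
      cases h with
      | single w =>
        refine .single ?_ ?_
        · rw [← cancel_mono b.hom]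
          simp [w]
        · rw [reassoc_of% w, Category.assoc]
          congr 1
          apply biprod.hom_ext' <;> simp [hl, hr]
    · obtain f' | ⟨f', cY⟩ := cY
      · nomatch cX
      cases h with
      | cons m w h =>
        refine .cons _ _ (by simp) ?_ ?_ (ih h)
        · rw [← cancel_mono m.hom]
          simp [w]
        · rw [reassoc_of% w]
          simp

end IsRetract

end Chain

section

variable {C : Type u} [Category.{v} C] [Preadditive C] [HasZeroObject C] [HasShift C ℤ]
  [∀ m : ℤ, (shiftFunctor C m).Additive] [Pretriangulated C]

/-- A retract of the first morphism of a distinguished triangle extends to a retract of the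
triangle. -/
lemma exists_retract_cone {U X V U' X' V' : C} {f : U ⟶ X} {p : X ⟶ V} {h : V ⟶ U⟦(1 : ℤ)⟧}
    {f' : U' ⟶ X'} {p' : X' ⟶ V'} {h' : V' ⟶ U'⟦(1 : ℤ)⟧} (hT : Triangle.mk f p h ∈ distTriang C)
    (hT' : Triangle.mk f' p' h' ∈ distTriang C) {iU : U ⟶ U'} {rU : U' ⟶ U} (hU : iU ≫ rU = 𝟙 U)
    {iX : X ⟶ X'} {rX : X' ⟶ X} (hX : iX ≫ rX = 𝟙 X) (wi : f ≫ iX = iU ≫ f')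
    (wr : f' ≫ rX = rU ≫ f) :
    ∃ (iV : V ⟶ V') (rV : V' ⟶ V), iV ≫ rV = 𝟙 V ∧ p ≫ iV = iX ≫ p' ∧ p' ≫ rV = rX ≫ p ∧
      h ≫ iU⟦(1 : ℤ)⟧' = iV ≫ h' ∧ h' ≫ rU⟦(1 : ℤ)⟧' = rV ≫ h := by
  obtain ⟨iV, hi₁, hi₂⟩ := dist_complete₃ hT hT' iU iX wi
  obtain ⟨rV, hr₁, hr₂⟩ := dist_complete₃ hT' hT rU rX wr
  have e₁ : p ≫ iV ≫ rV = p := by rw [reassoc_of% hi₁, hr₁, reassoc_of% hX]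
  have e₂ : (iV ≫ rV) ≫ h = h := by
    rw [Category.assoc, ← hr₂, ← reassoc_of% hi₂, ← Functor.map_comp, hU,
      CategoryTheory.Functor.map_id, Category.comp_id]
  have : IsIso (iV ≫ rV) := isIso_of_dist hT hT _ e₁ e₂
  -- The induced iV ≫ rV is only an automorphism of V compatible with p and h, so rV is corrected by
  -- its inverse.
  refine ⟨iV, rV ≫ inv (iV ≫ rV), by rw [← Category.assoc, IsIso.hom_inv_id], hi₁, ?_, hi₂, ?_⟩
  · rw [reassoc_of% hr₁]
    congr 1
    rw [IsIso.comp_inv_eq, e₁]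
  · rw [hr₂, Category.assoc]
    congr 1
    rw [IsIso.eq_inv_comp, e₂]

/-- The only candidate is iV ≫ g' ≫ rY. The required identities hold after p or p', and the
differences factor through U⟦1⟧ or U'⟦1⟧, so they vanish. -/
lemma retract_fill {U X V U' X' V' Y Y' : C} {f : U ⟶ X} {p : X ⟶ V} {h : V ⟶ U⟦(1 : ℤ)⟧}
    {f' : U' ⟶ X'} {p' : X' ⟶ V'} {h' : V' ⟶ U'⟦(1 : ℤ)⟧} (hT : Triangle.mk f p h ∈ distTriang C)
    (hT' : Triangle.mk f' p' h' ∈ distTriang C) {iX : X ⟶ X'} {rX : X' ⟶ X} (hX : iX ≫ rX = 𝟙 X)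
    {iV : V ⟶ V'} {rV : V' ⟶ V} (hi : p ≫ iV = iX ≫ p') (hr : p' ≫ rV = rX ≫ p)
    {g : X ⟶ Y} {g' : V' ⟶ Y'} {iY : Y ⟶ Y'} {rY : Y' ⟶ Y}
    (wi : g ≫ iY = iX ≫ p' ≫ g') (wr : (p' ≫ g') ≫ rY = rX ≫ g)
    (H : ∀ σ : U⟦(1 : ℤ)⟧ ⟶ Y', σ = 0) (H' : ∀ σ : U'⟦(1 : ℤ)⟧ ⟶ Y, σ = 0) :
    ∃ q : V ⟶ Y, p ≫ q = g ∧ q ≫ iY = iV ≫ g' ∧ g' ≫ rY = rV ≫ q := by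
  rw [Category.assoc] at wr
  have e : p ≫ iV ≫ g' ≫ rY = g := by rw [reassoc_of% hi, wr, reassoc_of% hX]
  refine ⟨iV ≫ g' ≫ rY, e, ?_, ?_⟩
  · obtain ⟨σ, hσ⟩ := dist_yoneda₃ hT ((iV ≫ g' ≫ rY) ≫ iY - iV ≫ g') (by
      rw [Preadditive.comp_sub, Category.assoc, Category.assoc, reassoc_of% e, wi, reassoc_of% hi,
        sub_self])
    rw [H σ, comp_zero] at hσ
    exact sub_eq_zero.mp hσ
  · obtain ⟨σ, hσ⟩ := dist_yoneda₃ hT' (g' ≫ rY - rV ≫ iV ≫ g' ≫ rY) (by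
      rw [Preadditive.comp_sub, wr, reassoc_of% hr, e, sub_self])
    rw [H' σ, comp_zero] at hσ
    exact sub_eq_zero.mp hσ

/-- A retract of a spliced sequence is spliced. -/
lemma SplK.retract {F : ObjectProperty C} {D : ℤ}
    (hF : ∀ X Y : C, F X → F Y → ∀ j : ℤ, 0 < j → j < D → ∀ f : X ⟶ Y⟦j⟧, f = 0)
    (hF' : ∀ X Y : C, F X → F Y → ∀ j : ℤ, j < 0 → -D < j → ∀ f : X ⟶ Y⟦j⟧, f = 0)
    {Z Z' : C} {iZ : Z ⟶ Z'} {rZ : Z' ⟶ Z} (hZ : iZ ≫ rZ = 𝟙 Z) {d : ℤ} {k : ℕ} {U U' : C}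
    {c : Chain Z k U} {c' : Chain Z' k U'} {κ : ShiftedHom Z' U' d} (hc : SplK c' κ)
    {iU : U ⟶ U'} {rU : U' ⟶ U} (hU : iU ≫ rU = 𝟙 U) (hr : Chain.IsRetract iZ rZ c c' iU rU)
    (hi : Inner F c) (hi' : Inner F c') (hdD : d ≤ D)
    (h₁ : iZ ≫ κ ≫ rU⟦d⟧' ≫ iU⟦d⟧' = iZ ≫ κ) (h₂ : rZ ≫ iZ ≫ κ ≫ rU⟦d⟧' = κ ≫ rU⟦d⟧')
    (H : ∀ Y, F Y → ∀ m : ℤ, -d < m → m < 0 → ∀ a : U' ⟶ Y⟦m⟧, a = 0) :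
    SplK c (iZ ≫ κ ≫ rU⟦d⟧' : ShiftedHom Z U d) := by
  -- `h₁` and `h₂` make the new connecting morphism iZ ≫ κ ≫ rU⟦d⟧ compatible with the inclusions
  -- and retractions. `H` stands in for membership of U' in F, which is lost for cosyzygies.
  induction hc generalizing U with
  | base e =>
    cases hr with
    | @single _ _ f _ _ _ wi wr =>
      let e' : U ≅ Z :=
        { hom := f
          inv := iZ ≫ e.inv ≫ rU
          hom_inv_id := by simp [reassoc_of% wi, hU]
          inv_hom_id := by simp [← wr, hZ] }
      have := SplK.base e'
      convert this using 1
      rw [mk₀_comp_map_shift]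
      simp [ShiftedHom.mk₀, e']
  | @splice U' X' V' d d' hd k f' p' h' hT' c₁' κ₁ hc₁ ih =>
    cases hr with
    | @cons _ _ _ X _ f _ c₁ _ _ _ iX rX hX wi wr hr =>
    -- With a single triangle left, all its morphisms are prescribed and it is a retract of a
    -- distinguished one. Otherwise the cosyzygy can be chosen as the cone of f.
    obtain hd₁ | hd₁ := hc₁.degree_nonneg.eq_or_lt
    · obtain q | ⟨q, c₁'⟩ := c₁'
      · obtain ⟨e, hd₀, rfl, rfl⟩ := hc₁.exists_of_single
        subst hd₁
        obtain rfl := (add_zero (1 : ℤ)).symm.trans hd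
        rw [ShiftedHom.mk₀_comp] at h₁ h₂ ⊢
        cases hr with
        | @single _ _ g _ _ _ wi' wr' =>
          have hT'' : Triangle.mk f' (p' ≫ e.hom) (e.inv ≫ h') ∈ distTriang C :=
            dist_of_iso hT' (Iso.refl _) (Iso.refl _) e (by simp) (by simp) (by simp)
          have hT : Triangle.mk f g (iZ ≫ (e.inv ≫ h') ≫ rU⟦(1 : ℤ)⟧') ∈ distTriang C :=
            dist_of_retract hT'' hU hX hZ wi wi'
              (by simpa only [Category.assoc] using h₁) wr wr' h₂.symm
          have := SplK.splice (add_zero 1) _ _ _ hT _ _ (SplK.base (Iso.refl Z))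
          simpa using this
      · obtain ⟨_, _, _, d₁, hd₂, _, _, _, _, _, hc₂⟩ := hc₁.exists_of_cons
        have := hc₂.degree_nonneg
        omega
    · obtain ⟨V, p, h, hT⟩ := distinguished_cocone_triangle f
      obtain ⟨iV, rV, hV, hi₁, hr₁, hi₂, hr₂⟩ := exists_retract_cone hT hT' hU hX wi wr
      have HU : ∀ Y, F Y → ∀ σ : U⟦(1 : ℤ)⟧ ⟶ Y, σ = 0 := fun Y hY σ => by
        refine shift_hom_eq_zero' (a := -1) (by norm_num) (fun t => ?_) σ
        rw [← Category.id_comp t, ← hU, Category.assoc, H Y hY (-1) (by omega) (by omega) (rU ≫ t),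
          comp_zero]
      have HU' : ∀ Y, F Y → ∀ σ : U'⟦(1 : ℤ)⟧ ⟶ Y, σ = 0 := fun Y hY σ =>
        shift_hom_eq_zero' (a := -1) (by norm_num) (H Y hY (-1) (by omega) (by omega)) σ
      have H₁ : ∀ Y, F Y → ∀ m : ℤ, -d < m → m < 0 → ∀ a : V' ⟶ Y⟦m⟧, a = 0 := by
        intro Y hY m hm hm₀ a
        obtain ⟨b, rfl⟩ := dist_yoneda₃ hT' a (hF' _ _ hi'.1 hY m hm₀ (by omega) _)
        rw [shift_hom_eq_zero (a := m - 1) (by ring) (H Y hY (m - 1) (by omega) (by omega)) b,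
          comp_zero]
      have comp_left {Y Y' V U : C} (a : Y ⟶ Y') (b : ShiftedHom Y' V d) (h : V ⟶ U⟦(1 : ℤ)⟧) :
          ShiftedHom.comp (a ≫ b : ShiftedHom Y V d) h hd = a ≫ b.comp h hd := by
        simp [ShiftedHom.comp]
      -- Composition with h is injective on morphisms Y ⟶ V⟦d⟧, since Hom(Y, X⟦d⟧) = 0 for 0 < d <
      -- D.
      have ext {Y X V U : C} {f : U ⟶ X} {p : X ⟶ V} {h : V ⟶ U⟦(1 : ℤ)⟧}
          (hT : Triangle.mk f p h ∈ distTriang C) (hY : F Y) (hX : F X) {a b : ShiftedHom Y V d}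
          (hab : a.comp h hd = b.comp h hd) : a = b := by
        obtain ⟨s, hs⟩ := dist_coyoneda₃_shift hT (a - b) hd (by
          rw [sub_eq_add_neg]
          refine (ShiftedHom.add_comp _ _ _ _).trans ?_
          rw [ShiftedHom.neg_comp, hab, add_neg_cancel])
        rw [hF _ _ hY hX d hd₁ (by omega) s, zero_comp] at hs
        exact sub_eq_zero.mp hs
      have e₁ : ShiftedHom.comp (κ₁ ≫ rV⟦d⟧' : ShiftedHom Z' V d) h hd =
          κ₁.comp h' hd ≫ rU⟦d'⟧' := by
        rw [map_shift_comp, ← hr₂, comp_map_shift]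
      have k₁ : iZ ≫ κ₁ ≫ rV⟦d⟧' ≫ iV⟦d⟧' = iZ ≫ κ₁ := by
        refine ext hT' hi.target hi'.1 ?_
        rw [comp_left iZ (κ₁ ≫ rV⟦d⟧' ≫ iV⟦d⟧'), comp_left iZ κ₁, ← h₁, ← Category.assoc κ₁, map_shift_comp, ← hi₂,
          ← comp_map_shift, e₁, Category.assoc]
      have k₂ : rZ ≫ iZ ≫ κ₁ ≫ rV⟦d⟧' = κ₁ ≫ rV⟦d⟧' := by
        refine ext hT hi'.target hi.1 ?_
        rw [comp_left, comp_left, e₁, h₂]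
      obtain ⟨c₂, rfl, hr'⟩ : ∃ c₂ : Chain Z k V, c₁ = c₂.precomp p ∧
          Chain.IsRetract iZ rZ c₂ c₁' iV rV := by
        obtain g' | ⟨g', c₁'⟩ := c₁'
        · cases hr with
          | @single _ _ g _ _ _ wi' wr' =>
            obtain ⟨q, hq, hq₁, hq₂⟩ := retract_fill hT hT' hX hi₁ hr₁ (by simpa using wi') wr'
              (HU _ hi'.target) (HU' _ hi.target)
            exact ⟨Chain.single q, by rw [← hq]; rfl, .single hq₁ hq₂⟩
        · cases hr with
          | @cons _ _ _ Y _ g _ c₂ _ _ _ iY rY hY wi' wr' hr =>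
            obtain ⟨q, hq, hq₁, hq₂⟩ := retract_fill hT hT' hX hi₁ hr₁ (by simpa using wi') wr'
              (HU _ hi'.2.1) (HU' _ hi.2.1)
            exact ⟨Chain.cons q c₂, by rw [← hq]; rfl, .cons iY rY hY hq₁ hq₂ hr⟩
      have key := SplK.splice hd f p h hT c₂ _ (ih hV hr' hi.2.of_precomp hi'.2.of_precomp
        (by omega) k₁ k₂ H₁)
      rw [comp_left, e₁] at key
      exact key

lemma mem_standardAngles_of_isIsomorphic_sum {F : ObjectProperty C}
    [HasBinaryBiproducts F.FullSubcategory] {D : ℤ}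
    (hF : ∀ X Y : C, F X → F Y → ∀ j : ℤ, 0 < j → j < D → ∀ f : X ⟶ Y⟦j⟧, f = 0)
    (hF' : ∀ X Y : C, F X → F Y → ∀ j : ℤ, j < 0 → -D < j → ∀ f : X ⟶ Y⟦j⟧, f = 0)
    {hS : ∀ X : C, F X → F (X⟦D⟧)} {n : ℕ} (hn : 3 ≤ n) (X Y Z : NSeq (restrictedShift F D hS) n)
    (hZ : Z ∈ standardAngles F D hS n) (h : Z.IsIsomorphic (X.sum Y)) :
    X ∈ standardAngles F D hS n := by
  obtain ⟨k, rfl⟩ := Nat.exists_eq_add_of_le' hn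
  let G := restrictedShift F D hS
  obtain ⟨Z₁, cZ⟩ := Z
  obtain ⟨X₁, cX⟩ := X
  obtain ⟨Y₁, cY⟩ := Y
  obtain ⟨e, he⟩ := h
  change Z₁ ≅ X₁ ⊞ Y₁ at e
  change Chain.IsIsomorphic (G.mapIso e) cZ
    (Chain.sum (G.map biprod.inl) (G.map biprod.inr) cX cY) e at he
  have hr := Chain.IsRetract.of_isIsomorphic (s := G.map biprod.fst)
    (by rw [← G.map_comp, biprod.inl_fst, G.map_id])
    (by rw [← G.map_comp, biprod.inr_fst, G.map_zero]) _ he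
  obtain ⟨VZ, cZ, gZ, rfl⟩ := cZ.exists_eq_snoc
  obtain ⟨VX, cX, gX, rfl⟩ := cX.exists_eq_snoc
  obtain ⟨iZ, rZ, hV, hr', h₁, h₂⟩ := hr.exists_of_snoc
  have hZ' := (snoc_mem_standardAngles_iff _ _).mp hZ
  refine (snoc_mem_standardAngles_iff _ _).mpr ?_
  have hU : (biprod.inl ≫ e.inv) ≫ e.hom ≫ biprod.fst = 𝟙 X₁ := by simp
  have e₁ : gX ≫ G.map (biprod.inl ≫ e.inv) = iZ ≫ gZ := 
    (gX ≫= G.map_comp _ _).trans h₁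
  have e₂ : gZ ≫ G.map (e.hom ≫ biprod.fst) = rZ ≫ gX := 
    (gZ ≫= G.map_comp _ _).trans h₂
  have e₃ : iZ ≫ gZ ≫ G.map (e.hom ≫ biprod.fst) = gX := by
    rw [← reassoc_of% e₁, ← G.map_comp, hU, G.map_id, Category.comp_id]
  have key := hZ'.retract hF hF' (iZ := F.ι.map iZ) (rZ := F.ι.map rZ)
    (by rw [← F.ι.map_comp, hV, F.ι.map_id])
    (iU := F.ι.map (biprod.inl ≫ e.inv)) (rU := F.ι.map (e.hom ≫ biprod.fst))
    (by rw [← F.ι.map_comp, hU, F.ι.map_id]) (hr'.map F.ι) (Inner.map_ι _) (Inner.map_ι _) le_rfl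
    (by
      have : iZ ≫ gZ ≫ G.map (e.hom ≫ biprod.fst) ≫ G.map (biprod.inl ≫ e.inv) = iZ ≫ gZ := by
        rw [reassoc_of% e₃, e₁]
      exact congrArg F.ι.map this)
    (by
      have : rZ ≫ iZ ≫ gZ ≫ G.map (e.hom ≫ biprod.fst) = gZ ≫ G.map (e.hom ≫ biprod.fst) := by
        rw [e₃, e₂]
      exact congrArg F.ι.map this)
    (fun Y hY m hm hm₀ a => hF' _ _ Z₁.property hY m hm₀ hm a)
  exact (congrArg (SplK _) (congrArg F.ι.map e₃)).mp key

end

end HigherAngulated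

end

/-! ### Assembly of the axioms. -/

theorem theorem3p1 {T : Type u} [Category.{v} T] [Preadditive T] [HasZeroObject T]
    [HasShift T ℤ] [∀ m : ℤ, (shiftFunctor T m).Additive] [Pretriangulated T] [IsTriangulated T]
    (n : ℕ) (hn : 3 ≤ n) (F : ObjectProperty T)
    (hF : HigherAngulated.IsClusterTilting (n - 2) F)
    (hS : ∀ X : T, F X → F (X⟦((n - 2 : ℕ) : ℤ)⟧)) :
    HigherAngulated.IsNAngulatedCategory F.FullSubcategory
      (HigherAngulated.restrictedShift F ((n - 2 : ℕ) : ℤ) hS) n hn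
      (HigherAngulated.standardAngles F ((n - 2 : ℕ) : ℤ) hS n) := by
  have h₀ := hF.hasZeroObject
  have h₁ := hF.hasBinaryBiproducts
  have hF₁ := hF.hom_eq_zero
  exact
    { hasZeroObject := h₀
      hasBinaryBiproducts := h₁
      isEquivalence := hF.isEquivalence_restrictedShift hS
      isNAngulation :=
        { F1_sum := fun X hX Y hY => HigherAngulated.sum_mem_standardAngles hn hX hY
          F1_summand := HigherAngulated.mem_standardAngles_of_isIsomorphic_sum hF₁
            (hF.hom_eq_zero_of_neg hS) hn
          F1_trivial := by
            obtain ⟨k, rfl⟩ := Nat.exists_eq_add_of_le' hn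
            exact fun X => HigherAngulated.trivial_mem_standardAngles _ X
          F1_exists := by
            obtain ⟨k, rfl⟩ := Nat.exists_eq_add_of_le' hn
            exact fun α₁ => HigherAngulated.IsClusterTilting.exists_mem_standardAngles hF α₁
          F2 := HigherAngulated.mem_standardAngles_iff_rotate_mem hn
          F3 := fun X hX Y hY φ₁ φ₂ w => by
            obtain ⟨φ, hφ, -⟩ := HigherAngulated.exists_hom_cone_mem hF₁ hn hX hY φ₁ φ₂ w
            exact ⟨φ, hφ⟩
          F4 := fun X hX Y hY => HigherAngulated.exists_hom_cone_mem hF₁ hn hX hY } }
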